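/- All graphs are finite and simple. For a graph $G$ put $P(G)=\prod_{uv\in E(G),\,u<v}(u-v)$, a polynomial with integer coefficients whose variables are the vertices of $G$, where $<$ fixes an arbitrary orientation of the edges (it affects only the sign of $P(G)$). A monomial is called non-vanishing in $P(G)$ if its coefficient in $P(G)$ is non-zero. Let $G$ be a 2-connected outerplane graph, i.e. the vertices are placed on a circle and the edges are non-crossing chords. Its weak dual has the inner (bounded) faces as vertices, two of them being adjacent if they have a common edge. For non-adjacent vertices $x,y$, the fundamental $x$–$y$ subgraph of $G$ is the subgraph induced by the vertices belonging to the faces on the shortest path in the weak dual between a face containing $x$ and a face containing $y$; if $xy\in E(G)$, it is the edge $xy$. $G$ is $xy$-fundamental if its fundamental $x$–$y$ subgraph is $G$ itself. Theorem. Let $G$ be a 2-connected $xy$-fundamental outerplane graph with exactly one non-triangular inner face, and suppose that this face contains $x$ and does not contain $y$. Let $a,b$ be the two vertices which this face shares with the neighbouring inner face. Let $C$ be a proper 3-colouring of the subgraph of $G$ induced by the vertices of all triangular inner faces (it is unique up to a permutation of the colours). Then: 1. if ($xa\in E(G)$ and $C(a)=C(y)$) or ($xb\in E(G)$ and $C(b)=C(y)$),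 then $P(G)$ has a non-vanishing monomial in which $x$ has exponent $0$, $y$ has exponent $1$, and every other vertex has exponent at most $2$; 2. otherwise, $P(G)$ has a non-vanishing monomial in which $x$ and $y$ both have exponent $0$ and every other vertex has exponent at most $2$. -/

import Mathlib

/-- `r` orients every edge of `G` in exactly one of its two directions. -/
def SimpleGraph.IsOrientation {V : Type*} (G : SimpleGraph V) (r : V → V → Prop) : Prop :=
  ∀ u v, G.Adj u v → (r u v ↔ ¬ r v u)

open scoped Classical in
/-- The graph polynomial: the product of `u - v` over the edges `uv` of `G`, each edge being
taken once, in the direction given by the orientation `r`. -/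
noncomputable def SimpleGraph.graphPolynomial {V : Type*} [Fintype V] (G : SimpleGraph V)
    (r : V → V → Prop) : MvPolynomial V ℤ :=
  ∏ e : V × V with G.Adj e.1 e.2 ∧ r e.1 e.2, (MvPolynomial.X e.1 - MvPolynomial.X e.2)

/-- `G` is 2-connected: it has at least three vertices, is connected and has no cutvertex. -/
def SimpleGraph.IsTwoConnected {V : Type*} [Fintype V] (G : SimpleGraph V) : Prop :=
  3 ≤ Fintype.card V ∧ G.Connected ∧ ∀ v : V, (G.induce {v}ᶜ).Connected

/-- An outerplane drawing of `G`: the vertices are placed on a circle (in convex position), numbered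
`0, 1, …, n - 1` in the order in which they occur along it, and the edges, drawn as straight
chords, do not cross.  Two chords cross iff their ends alternate along the circle. -/
structure OuterplaneDrawing {V : Type*} [Fintype V] (G : SimpleGraph V) where
  pos : V ≃ Fin (Fintype.card V)
  noncrossing : ∀ a b c d, G.Adj a b → G.Adj c d →
    ¬ (pos a < pos c ∧ pos c < pos b ∧ pos b < pos d)

namespace OuterplaneDrawing

variable {V : Type*} [Fintype V] {G : SimpleGraph V} (D : OuterplaneDrawing G)

/-- `w` lies on the open arc of the circle between `u` and `v` that does not contain the point
where the numbering starts over.  The vertices that are different from `u` and `v` and not on this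
arc are the ones on the other open arc between `u` and `v`. -/
def OnArc (u v w : V) : Prop :=
  (D.pos u < D.pos w ∧ D.pos w < D.pos v) ∨ (D.pos v < D.pos w ∧ D.pos w < D.pos u)

/-- `u` and `v` are consecutive in `S` along the circle, that is, `uv` is a side of the convex
polygon with vertex set `S`: one of the two open arcs between `u` and `v` has no vertex of `S`. -/
def IsSide (S : Finset V) (u v : V) : Prop :=
  (∀ w ∈ S, ¬ D.OnArc u v w) ∨ (∀ w ∈ S, w ≠ u → w ≠ v → D.OnArc u v w)

/-- `S` is the vertex set of an inner (bounded) face of the drawing: the convex polygon spanned by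
`S` has all its sides in `G`, and no edge of `G` runs through its interior, i.e. none of its
diagonals is an edge.  (An edge which meets the interior and is not a diagonal would
cross a side.) -/
def IsInnerFace (S : Finset V) : Prop :=
  3 ≤ S.card ∧ ∀ u ∈ S, ∀ v ∈ S, u ≠ v → (G.Adj u v ↔ D.IsSide S u v)

/-- The weak dual: its vertices are the inner faces, two of them being adjacent when they are
different and have a common edge on their boundaries. -/
def weakDual : SimpleGraph {S : Finset V // D.IsInnerFace S} where
  Adj F F' := F ≠ F' ∧ ∃ u v, G.Adj u v ∧ (u ∈ F.1 ∧ v ∈ F.1) ∧ (u ∈ F'.1 ∧ v ∈ F'.1)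
  symm := ⟨fun _ _ h => ⟨h.1.symm, by
    obtain ⟨_, u, v, huv, h1, h2⟩ := h
    exact ⟨u, v, huv, h2, h1⟩⟩⟩
  loopless := ⟨fun _ h => h.1 rfl⟩

/-- `p` is a shortest walk (hence a path) in the weak dual from a face on which `x` lies to a face
on which `y` lies. -/
def IsShortestFacePath (x y : V) {F F' : {S : Finset V // D.IsInnerFace S}}
    (p : D.weakDual.Walk F F') : Prop :=
  x ∈ F.1 ∧ y ∈ F'.1 ∧
    ∀ (E E' : {S : Finset V // D.IsInnerFace S}) (q : D.weakDual.Walk E E'),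
      x ∈ E.1 → y ∈ E'.1 → p.length ≤ q.length

open scoped Classical in
/-- The vertex set of the fundamental `x - y` subgraph of a 2-connected outerplane graph. -/
noncomputable def fundamentalVerts (x y : V) : Set V :=
  if G.Adj x y then {x, y}
  else {v | ∃ (F F' : {S : Finset V // D.IsInnerFace S}) (p : D.weakDual.Walk F F'),
    D.IsShortestFacePath x y p ∧ ∃ S ∈ p.support, v ∈ S.1}

/-- The fundamental `x - y` subgraph of a 2-connected outerplane graph. -/
noncomputable def fundamentalSubgraph (x y : V) : G.Subgraph :=
  (⊤ : G.Subgraph).induce (D.fundamentalVerts x y)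

/-- A 2-connected outerplane graph is `xy`-fundamental if it equals its fundamental `x - y`
subgraph. -/
def IsFundamental (x y : V) : Prop :=
  D.fundamentalSubgraph x y = ⊤

/-- `v` lies on a triangular inner face. -/
def OnTriangularFace (v : V) : Prop :=
  ∃ S : Finset V, D.IsInnerFace S ∧ S.card = 3 ∧ v ∈ S

/-- `C` restricts to a proper 3-colouring of the subgraph of `G` induced by the vertices of all
the triangular inner faces (its values at the other vertices are irrelevant). -/
def IsTriangularColouring (C : V → Fin 3) : Prop :=
  ∀ u v, D.OnTriangularFace u → D.OnTriangularFace v → G.Adj u v → C u ≠ C v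

end OuterplaneDrawing

/-! ### Non-zero coefficients from the Combinatorial Nullstellensatz -/

open MvPolynomial in
/-- A product of lists on which a polynomial of low degree has exactly one non-root certifies a
non-zero coefficient. -/
theorem MvPolynomial.coeff_ne_zero_of_unique_eval_ne_zero {R σ : Type*} [CommRing R] [IsDomain R]
    [Finite σ] [DecidableEq R]
    (P : MvPolynomial σ R) (t : σ →₀ ℕ) (hP : P.totalDegree ≤ t.degree)
    (K : σ → Finset R) (hK : ∀ i, (K i).card = t i + 1) (c : σ → R) (hc : ∀ i, c i ∈ K i)
    (hc0 : eval c P ≠ 0) (huniq : ∀ d : σ → R, (∀ i, d i ∈ K i) → eval d P ≠ 0 → d = c) :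
    P.coeff t ≠ 0 := by
  classical
  cases nonempty_fintype σ
  let _ : LinearOrder σ := WellOrderingRel.isWellOrder.linearOrder
  let m : MonomialOrder σ := MonomialOrder.degLex
  -- On the grid `∏ K i` the product `Q` is non-zero only at `c`, and its leading monomial is `t`
  -- with coefficient one.
  let q : σ → MvPolynomial σ R := fun i => ∏ s ∈ (K i).erase (c i), (X i - C s)
  let Q : MvPolynomial σ R := ∏ i, q i
  have hqdeg : ∀ i, m.degree (q i) = Finsupp.single i (t i) := by
    intro i
    have h : ∀ s ∈ (K i).erase (c i), m.leadingCoeff (X i - C s : MvPolynomial σ R) ∈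
        nonZeroDivisors R := fun s _ => by
      rw [(m.monic_X_sub_C i s)]; exact one_mem _
    simp only [q]
    rw [m.degree_prod_of_mem_nonZeroDivisors h]
    simp [m.degree_X_sub_C, Finset.card_erase_of_mem (hc i), hK i]
  have hqmon : ∀ i, m.Monic (q i) := fun i =>
    MonomialOrder.Monic.prod fun s _ => m.monic_X_sub_C i s
  have hQdeg : m.degree Q = t := by
    have h : ∀ i ∈ Finset.univ, m.leadingCoeff (q i) ∈ nonZeroDivisors R := fun i _ => by
      rw [hqmon i]; exact one_mem _
    simp only [Q]
    rw [m.degree_prod_of_mem_nonZeroDivisors h]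
    simp only [hqdeg]
    ext j
    simp
  have hQcoeff : Q.coeff t = 1 := by
    have : m.Monic Q := MonomialOrder.Monic.prod fun i _ => hqmon i
    rw [← hQdeg]; exact this
  have hQtot : Q.totalDegree ≤ t.degree := by
    refine (totalDegree_finsetProd _ _).trans ?_
    rw [Finsupp.degree_eq_sum]
    refine Finset.sum_le_sum fun i _ => ?_
    refine (totalDegree_finsetProd _ _).trans ?_
    refine (Finset.sum_le_card_nsmul _ _ 1 fun s _ => ?_).trans ?_
    · refine (totalDegree_sub _ _).trans ?_
      simp
    · simp [Finset.card_erase_of_mem (hc i), hK i]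
  have hQeval : eval c Q ≠ 0 := by
    simp only [Q, q, map_prod, map_sub, eval_X, eval_C]
    refine Finset.prod_ne_zero_iff.2 fun i _ => Finset.prod_ne_zero_iff.2 fun s hs => ?_
    rw [sub_ne_zero]
    exact (Finset.ne_of_mem_erase hs).symm
  intro hcoef
  -- Its coefficient at `t` would be `-P(c) ≠ 0`, yet it vanishes on the whole grid: at `c` by
  -- cancellation, elsewhere because both `P` and `Q` do.
  let F : MvPolynomial σ R := C (eval c Q) * P - C (eval c P) * Q
  have hFcoef : F.coeff t ≠ 0 := by
    simp only [F, coeff_sub, coeff_C_mul, hcoef, hQcoeff]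
    simpa using hc0
  have hFtot : F.totalDegree = t.degree := by
    refine le_antisymm ?_ (le_totalDegree (mem_support_iff.2 hFcoef))
    refine (totalDegree_sub _ _).trans (max_le ?_ ?_)
    · refine (totalDegree_mul _ _).trans ?_
      simpa using hP
    · refine (totalDegree_mul _ _).trans ?_
      simpa using hQtot
  obtain ⟨d, hdK, hd⟩ := combinatorial_nullstellensatz_exists_eval_nonzero F t hFcoef hFtot K
    (fun i => by rw [hK i]; exact Nat.lt_succ_self _)
  apply hd
  by_cases hdc : d = c
  · subst hdc
    simp [F, mul_comm]
  · have h1 : eval d P = 0 := by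
      by_contra h
      exact hdc (huniq d hdK h)
    have h2 : eval d Q = 0 := by
      obtain ⟨i, hi⟩ := Function.ne_iff.1 hdc
      simp only [Q, q, map_prod, map_sub, eval_X, eval_C]
      refine Finset.prod_eq_zero (Finset.mem_univ i) ?_
      exact Finset.prod_eq_zero (Finset.mem_erase.2 ⟨hi, hdK i⟩) (sub_self _)
    simp [F, h1, h2]

/-! ### The graph polynomial and unique list colourings -/

namespace SimpleGraph

variable {V : Type*} [Fintype V] {G : SimpleGraph V} {r : V → V → Prop}

theorem eval_graphPolynomial_ne_zero_iff (hr : G.IsOrientation r) (c : V → ℤ) :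
    MvPolynomial.eval c (G.graphPolynomial r) ≠ 0 ↔ ∀ u v, G.Adj u v → c u ≠ c v := by
  classical
  simp only [graphPolynomial, map_prod, map_sub, MvPolynomial.eval_X, Finset.prod_ne_zero_iff,
    sub_ne_zero, Finset.mem_filter, Finset.mem_univ, true_and, Prod.forall]
  refine ⟨fun h u v huv => ?_, fun h u v huv => h u v huv.1⟩
  by_cases hv : r u v
  · exact h u v ⟨huv, hv⟩
  · exact (h v u ⟨huv.symm, by by_contra h'; exact hv ((hr u v huv).2 h')⟩).symm

theorem totalDegree_graphPolynomial_le (hr : G.IsOrientation r) (A : Finset (Sym2 V))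
    (hA : ∀ u v, G.Adj u v → s(u, v) ∈ A) :
    (G.graphPolynomial r).totalDegree ≤ A.card := by
  classical
  refine (MvPolynomial.totalDegree_finsetProd _ _).trans ?_
  refine (Finset.sum_le_card_nsmul _ _ 1 fun e _ => ?_).trans ?_
  · refine (MvPolynomial.totalDegree_sub _ _).trans ?_
    simp
  · rw [smul_eq_mul, mul_one]
    refine Finset.card_le_card_of_injOn (fun e => s(e.1, e.2)) ?_ ?_
    · rintro ⟨u, v⟩ he
      simp only [Finset.coe_filter, Finset.mem_univ, true_and, Set.mem_ofPred_eq] at he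
      exact hA u v he.1
    · rintro ⟨u, v⟩ he ⟨u', v'⟩ he' h
      simp only [Finset.coe_filter, Finset.mem_univ, true_and, Set.mem_ofPred_eq] at he he'
      simp only [Sym2.eq_iff] at h
      rcases h with ⟨rfl, rfl⟩ | ⟨rfl, rfl⟩
      · rfl
      · exact absurd he'.2 ((hr _ _ he.1).1 he.2)

/-- If a graph has exactly one proper colouring from lists of sizes `t v + 1`, and at most `∑ t`
edges, then the monomial with exponents `t` is non-vanishing. -/
theorem coeff_graphPolynomial_ne_zero (hr : G.IsOrientation r) (A : Finset (Sym2 V))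
    (hA : ∀ u v, G.Adj u v → s(u, v) ∈ A) (t : V →₀ ℕ) (hAt : A.card ≤ ∑ v, t v)
    (K : V → Finset ℤ) (hK : ∀ v, (K v).card = t v + 1) (c : V → ℤ) (hc : ∀ v, c v ∈ K v)
    (hproper : ∀ u v, G.Adj u v → c u ≠ c v)
    (huniq : ∀ d : V → ℤ, (∀ v, d v ∈ K v) → (∀ u v, G.Adj u v → d u ≠ d v) → d = c) :
    (G.graphPolynomial r).coeff t ≠ 0 := by
  classical
  refine MvPolynomial.coeff_ne_zero_of_unique_eval_ne_zero _ t ?_ K hK c hc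
    ((eval_graphPolynomial_ne_zero_iff hr c).2 hproper)
    fun d hd hd' => huniq d hd ((eval_graphPolynomial_ne_zero_iff hr d).1 hd')
  rw [Finsupp.degree_eq_sum]
  exact (totalDegree_graphPolynomial_le hr A hA).trans hAt

end SimpleGraph

/-! ### 2-trees and their 3-colourings -/

namespace SimpleGraph

/-- `T` is built from a triangle of `G` by repeatedly adding a vertex whose neighbours
among the previous ones are the two ends of an edge. -/
inductive IsTwoTree {V : Type*} [DecidableEq V] (G : SimpleGraph V) : Finset V → Prop
  | triangle {u v w : V} (huv : G.Adj u v) (huw : G.Adj u w) (hvw : G.Adj v w) :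
      IsTwoTree G {u, v, w}
  | step {T : Finset V} {u v w : V} (hT : IsTwoTree G T) (hu : u ∈ T) (hv : v ∈ T)
      (huv : G.Adj u v) (hw : w ∉ T) (hwu : G.Adj w u) (hwv : G.Adj w v)
      (h : ∀ z ∈ T, G.Adj w z → z = u ∨ z = v) : IsTwoTree G (insert w T)

namespace IsTwoTree

variable {V : Type*} [DecidableEq V] {G : SimpleGraph V} {T : Finset V}

/-- The initial triangle has three edges on three vertices, and every further vertex brings at most
two. -/
theorem exists_edges (hT : G.IsTwoTree T) : ∃ A : Finset (Sym2 V), A.card + 3 ≤ 2 * T.card ∧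
    ∀ u ∈ T, ∀ v ∈ T, G.Adj u v → s(u, v) ∈ A := by
  induction hT with
  | @triangle u v w huv huw hvw =>
    refine ⟨{s(u, v), s(u, w), s(v, w)}, ?_, ?_⟩
    · rw [Finset.card_eq_three.2 ⟨u, v, w, huv.ne, huw.ne, hvw.ne, rfl⟩]
      have := Finset.card_le_three (a := s(u, v)) (b := s(u, w)) (c := s(v, w))
      omega
    · intro p hp q hq hpq
      simp only [Finset.mem_insert, Finset.mem_singleton] at hp hq ⊢
      have := hpq.ne
      rcases hp with rfl | rfl | rfl <;> rcases hq with rfl | rfl | rfl <;>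
        simp_all [Sym2.eq_swap]
  | @step T u v w hT hu hv huv hw hwu hwv h ih =>
    obtain ⟨A, hA, hA'⟩ := ih
    refine ⟨insert s(w, u) (insert s(w, v) A), ?_, ?_⟩
    · rw [Finset.card_insert_of_notMem hw]
      have h1 := Finset.card_insert_le s(w, u) (insert s(w, v) A)
      have h2 := Finset.card_insert_le s(w, v) A
      omega
    · intro p hp q hq hpq
      simp only [Finset.mem_insert] at hp hq ⊢
      rcases hp with rfl | hp <;> rcases hq with rfl | hq
      · exact absurd rfl hpq.ne
      · rcases h q hq hpq with rfl | rfl <;> simp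
      · rw [Sym2.eq_swap]
        rcases h p hp hpq.symm with rfl | rfl <;> simp
      · exact Or.inr (Or.inr (hA' p hp q hq hpq))

/-- Any two proper 3-colourings have the same colour classes. -/
theorem eq_iff_eq_of_colouring (hT : G.IsTwoTree T) {C c : V → Fin 3}
    (hC : ∀ u ∈ T, ∀ v ∈ T, G.Adj u v → C u ≠ C v)
    (hc : ∀ u ∈ T, ∀ v ∈ T, G.Adj u v → c u ≠ c v) :
    ∀ u ∈ T, ∀ v ∈ T, (C u = C v ↔ c u = c v) := by
  induction hT with
  | @triangle u v w huv huw hvw =>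
    have h1 := hC u (by simp) v (by simp) huv
    have h2 := hC u (by simp) w (by simp) huw
    have h3 := hC v (by simp) w (by simp) hvw
    have h4 := hc u (by simp) v (by simp) huv
    have h5 := hc u (by simp) w (by simp) huw
    have h6 := hc v (by simp) w (by simp) hvw
    intro p hp q hq
    simp only [Finset.mem_insert, Finset.mem_singleton] at hp hq
    rcases hp with rfl | rfl | rfl <;> rcases hq with rfl | rfl | rfl <;>
      simp [h1, h2, h3, h4, h5, h6, h1.symm, h2.symm, h3.symm, h4.symm, h5.symm, h6.symm]
  | @step T u v w hT hu hv huv hw hwu hwv h ih =>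
    have ih := ih (fun p hp q hq => hC p (by simp [hp]) q (by simp [hq]))
      (fun p hp q hq => hc p (by simp [hp]) q (by simp [hq]))
    have h1 := hC u (by simp [hu]) v (by simp [hv]) huv
    have h2 := hC w (by simp) u (by simp [hu]) hwu
    have h3 := hC w (by simp) v (by simp [hv]) hwv
    have h4 := hc u (by simp [hu]) v (by simp [hv]) huv
    have h5 := hc w (by simp) u (by simp [hu]) hwu
    have h6 := hc w (by simp) v (by simp [hv]) hwv
    -- With three colours, `w` agrees with `z` exactly when `z` differs from both `u` and `v`, which
    -- the induction hypothesis controls.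
    have key : ∀ z ∈ T, (C w = C z ↔ c w = c z) := by
      intro z hz
      have h7 := ih z hz u hu
      have h8 := ih z hz v hv
      simp only [Fin.ext_iff, ne_eq] at *
      omega
    intro p hp q hq
    simp only [Finset.mem_insert] at hp hq
    rcases hp with rfl | hp <;> rcases hq with rfl | hq
    · simp
    · exact key q hq
    · rw [eq_comm, key p hp, eq_comm]
    · exact ih p hp q hq

/-- Two proper 3-colourings agreeing at two vertices of different colours are equal. -/
theorem eq_of_colouring (hT : G.IsTwoTree T) {C c : V → Fin 3}
    (hC : ∀ u ∈ T, ∀ v ∈ T, G.Adj u v → C u ≠ C v)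
    (hc : ∀ u ∈ T, ∀ v ∈ T, G.Adj u v → c u ≠ c v) {p q : V} (hp : p ∈ T) (hq : q ∈ T)
    (hpq : C p ≠ C q) (hcp : c p = C p) (hcq : c q = C q) : ∀ v ∈ T, c v = C v := by
  intro v hv
  have h1 := hT.eq_iff_eq_of_colouring hC hc v hv p hp
  have h2 := hT.eq_iff_eq_of_colouring hC hc v hv q hq
  simp only [Fin.ext_iff, ne_eq] at *
  omega

end IsTwoTree

/-! ### Lists on a 2-tree with a path attached to it -/

variable {V : Type*} [Fintype V] {G : SimpleGraph V} {r : V → V → Prop}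

/-- A path `f 0, …, f (m - 1)` attached to a 2-tree `T` at its ends, with base lists on `T` that
allow only the colouring `C`.  The vertex `f s` gets exponent `0`, the end `f (m - 1)` absorbs one
edge of the path. -/
theorem exists_coeff_ne_zero_of_isTwoTree [DecidableEq V] (hr : G.IsOrientation r) {T : Finset V}
    (hT : G.IsTwoTree T) (C : V → Fin 3) (hC : ∀ u ∈ T, ∀ v ∈ T, G.Adj u v → C u ≠ C v)
    (f : ℕ → V) (m s : ℕ) (hs : 2 ≤ s) (hsm : s + 2 ≤ m)
    (hinj : ∀ i < m, ∀ j < m, f i = f j → i = j) (h0 : f 0 ∈ T) (hlast : f (m - 1) ∈ T)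
    (hmid : ∀ i, 0 < i → i + 1 < m → f i ∉ T)
    (hcov : ∀ v, v ∈ T ∨ ∃ i, 0 < i ∧ i + 1 < m ∧ f i = v)
    (hadj : ∀ i, i + 1 < m → G.Adj (f i) (f (i + 1)))
    (hedge : ∀ u v, G.Adj u v → (u ∈ T ∧ v ∈ T) ∨ ∃ i, i + 1 < m ∧ s(u, v) = s(f i, f (i + 1)))
    (B : V → Finset (Fin 3)) (hB : ∀ v ∈ T, C v ∈ B v)
    (hBuniq : ∀ c : V → Fin 3, (∀ v ∈ T, c v ∈ B v) →
      (∀ u ∈ T, ∀ v ∈ T, G.Adj u v → c u ≠ c v) → ∀ v ∈ T, c v = C v)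
    (hBcard : 3 * T.card ≤ ∑ v ∈ T, (B v).card + 3) :
    ∃ μ : V →₀ ℕ, (G.graphPolynomial r).coeff μ ≠ 0 ∧ μ (f s) = 0 ∧
      (∀ v ∈ T, v ≠ f (m - 1) → μ v + 1 = (B v).card) ∧
      μ (f (m - 1)) = (B (f (m - 1))).card ∧ ∀ v ∉ T, μ v ≤ 2 := by
  obtain ⟨idx, hidx⟩ : ∃ idx : V → ℕ, ∀ i < m, idx (f i) = i := by
    have : Nonempty V := ⟨f 0⟩
    have hI : Set.InjOn f {i | i < m} := fun i hi j hj h => hinj i hi j hj h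
    exact ⟨Function.invFunOn f {i | i < m}, fun i hi => hI.leftInvOn_invFunOn hi⟩
  let φ : Fin 3 → ℤ := fun k => ((k : ℕ) : ℤ)
  have hφ : Function.Injective φ := fun p q h => by
    simp only [φ] at h
    exact Fin.ext (by exact_mod_cast h)
  have hφlt : ∀ k, φ k < 3 := fun k => by
    have := k.2
    simp only [φ]
    omega
  -- The intended colour of `f i` is `3 + i`. The alternative is the colour of the predecessor after
  -- `s` and of the successor before `s`, so colours propagate from the singleton at `s` in both
  -- directions. The alternatives at `f 1` are the colours of its two neighbours; its third colour
  -- makes up for the singleton.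
  let LO : ℕ → Finset ℤ := fun i => if i = s then {3 + (i : ℤ)} else
    if i = 1 then {4, 5, φ (C (f 0))} else
    if i < s then {3 + (i : ℤ), 4 + (i : ℤ)} else {3 + (i : ℤ), 2 + (i : ℤ)}
  -- The extra colour `m + 1 = 3 + (m - 2)` is the forced colour of the neighbour `f (m - 2)`, so it
  -- raises the exponent without ever being usable.
  let K : V → Finset ℤ := fun v => if v ∈ T then
    (B v).image φ ∪ (if v = f (m - 1) then {(m : ℤ) + 1} else ∅) else LO (idx v)
  let c : V → ℤ := fun v => if v ∈ T then φ (C v) else 3 + (idx v : ℤ)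
  have hLOcard : ∀ i, (LO i).card = if i = s then 1 else if i = 1 then 3 else 2 := by
    intro i
    have h := hφlt (C (f 0))
    simp only [LO]
    split_ifs
    · simp
    · exact Finset.card_eq_three.2 ⟨_, _, _, by omega, by omega, by omega, rfl⟩
    · exact Finset.card_pair (by omega)
    · exact Finset.card_pair (by omega)
  have hKT : ∀ v ∈ T, v ≠ f (m - 1) → (K v).card = (B v).card := by
    intro v hv hvm
    simp [K, hv, hvm, Finset.card_image_of_injective _ hφ]
  have hKlast : (K (f (m - 1))).card = (B (f (m - 1))).card + 1 := by
    simp only [K, hlast, if_true]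
    rw [Finset.card_union_of_disjoint, Finset.card_image_of_injective _ hφ,
      Finset.card_singleton]
    rw [Finset.disjoint_singleton_right, Finset.mem_image]
    rintro ⟨k, -, hk⟩
    have := hφlt k
    omega
  have hKO : ∀ i, 0 < i → i + 1 < m → K (f i) = LO i := by
    intro i hi him
    simp only [K, hmid i hi him, if_false, hidx i (by omega)]
  have hcO : ∀ i, 0 < i → i + 1 < m → c (f i) = 3 + (i : ℤ) := by
    intro i hi him
    simp only [c, hmid i hi him, if_false, hidx i (by omega)]
  have hcT : ∀ v ∈ T, c v = φ (C v) := fun v hv => by simp only [c, hv, if_true]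
  have hBpos : ∀ v ∈ T, 0 < (B v).card := fun v hv => Finset.card_pos.2 ⟨_, hB v hv⟩
  have hKpos : ∀ v, 0 < (K v).card := by
    intro v
    rcases hcov v with hv | ⟨i, hi, him, rfl⟩
    · have := hBpos v hv
      by_cases h : v = f (m - 1)
      · subst h; omega
      · rw [hKT v hv h]; exact this
    · rw [hKO i hi him, hLOcard]
      split_ifs <;> omega
  let μ : V →₀ ℕ := Finsupp.equivFunOnFinite.symm fun v => (K v).card - 1
  have hμ : ∀ v, (K v).card = μ v + 1 := by
    intro v
    have := hKpos v
    simp only [μ, Finsupp.equivFunOnFinite_symm_apply_apply]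
    omega
  have hμO : ∀ i, 0 < i → i + 1 < m →
      μ (f i) + (if s = i then 1 else 0) = 1 + (if 1 = i then 1 else 0) := by
    intro i hi him
    have h := hμ (f i)
    rw [hKO i hi him, hLOcard] at h
    split_ifs at h ⊢ <;> omega
  obtain ⟨A, hAcard, hA⟩ := hT.exists_edges
  refine ⟨μ, ?_, ?_, ?_, ?_, ?_⟩
  · refine coeff_graphPolynomial_ne_zero hr
      (A ∪ (Finset.range (m - 1)).image fun i => s(f i, f (i + 1))) ?_ μ ?_ K hμ c ?_ ?_ ?_
    · intro u v huv
      rw [Finset.mem_union]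
      rcases hedge u v huv with ⟨hu, hv⟩ | ⟨i, hi, h⟩
      · exact Or.inl (hA u hu v hv huv)
      · exact Or.inr (Finset.mem_image.2 ⟨i, Finset.mem_range.2 (by omega), h.symm⟩)
    · refine (Finset.card_union_le _ _).trans ?_
      have h1 : ((Finset.range (m - 1)).image fun i => s(f i, f (i + 1))).card ≤ m - 1 :=
        Finset.card_image_le.trans (by simp)
      have hdisj : Disjoint T ((Finset.Ioo 0 (m - 1)).image f) := by
        rw [Finset.disjoint_left]
        intro v hv hv'
        obtain ⟨i, hi, rfl⟩ := Finset.mem_image.1 hv'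
        rw [Finset.mem_Ioo] at hi
        exact hmid i hi.1 (by omega) hv
      have huniv : (Finset.univ : Finset V) = T ∪ (Finset.Ioo 0 (m - 1)).image f := by
        ext v
        simp only [Finset.mem_univ, Finset.mem_union, Finset.mem_image, Finset.mem_Ioo, true_iff]
        rcases hcov v with hv | ⟨i, hi, him, h⟩
        · exact Or.inl hv
        · exact Or.inr ⟨i, ⟨hi, by omega⟩, h⟩
      rw [huniv, Finset.sum_union hdisj, Finset.sum_image fun i hi j hj h => by
        rw [Finset.mem_coe, Finset.mem_Ioo] at hi hj
        exact hinj i (by omega) j (by omega) h]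
      -- Exponent 1 at each of the `m - 2` inner vertices, the loss at `f s` cancelling the gain at
      -- `f 1`. The unit absorbed by `f (m - 1)` completes the `m - 1` path edges.
      have hout : ∑ i ∈ Finset.Ioo 0 (m - 1), μ (f i) = m - 2 := by
        have h2 : ∑ i ∈ Finset.Ioo 0 (m - 1), (μ (f i) + (if s = i then 1 else 0)) =
            ∑ i ∈ Finset.Ioo 0 (m - 1), (1 + (if 1 = i then 1 else 0)) :=
          Finset.sum_congr rfl fun i hi => by
            rw [Finset.mem_Ioo] at hi
            exact hμO i hi.1 (by omega)
        rw [Finset.sum_add_distrib, Finset.sum_add_distrib, Finset.sum_ite_eq,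
          Finset.sum_ite_eq, if_pos (by rw [Finset.mem_Ioo]; omega),
          if_pos (by rw [Finset.mem_Ioo]; omega)] at h2
        simp only [Finset.sum_const, Nat.card_Ioo, smul_eq_mul, mul_one] at h2
        omega
      have hin : ∑ v ∈ T, μ v + T.card = ∑ v ∈ T, (B v).card + 1 := by
        have h3 : ∑ v ∈ T, (μ v + 1) =
            ∑ v ∈ T, ((B v).card + (if f (m - 1) = v then 1 else 0)) :=
          Finset.sum_congr rfl fun v hv => by
            rw [← hμ v]
            split_ifs with h
            · subst h; exact hKlast
            · exact hKT v hv (Ne.symm h)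
        rw [Finset.sum_add_distrib, Finset.sum_add_distrib, Finset.sum_ite_eq,
          if_pos hlast] at h3
        simpa using h3
      omega
    · intro v
      rcases hcov v with hv | ⟨i, hi, him, rfl⟩
      · rw [hcT v hv]
        simp only [K, hv, if_true]
        exact Finset.mem_union_left _ (Finset.mem_image_of_mem _ (hB v hv))
      · rw [hKO i hi him, hcO i hi him]
        simp only [LO]
        split_ifs with h1 h2
        · simp
        · subst h2; simp
        · simp
        · simp
    · have hstep : ∀ i, i + 1 < m → c (f i) ≠ c (f (i + 1)) := by
        intro i him
        rcases Nat.eq_zero_or_pos i with rfl | hi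
        · rw [hcT _ h0, hcO (0 + 1) (by omega) (by omega)]
          have := hφlt (C (f 0))
          push_cast
          omega
        · rw [hcO i hi him]
          rcases Nat.lt_or_ge (i + 2) m with h | h
          · rw [hcO (i + 1) (by omega) h]
            push_cast
            omega
          · have : i + 1 = m - 1 := by omega
            rw [this, hcT _ hlast]
            have := hφlt (C (f (m - 1)))
            omega
      intro u v huv
      rcases hedge u v huv with ⟨hu, hv⟩ | ⟨i, hi, h⟩
      · rw [hcT u hu, hcT v hv]
        exact fun h => hC u hu v hv huv (hφ h)
      · rcases Sym2.eq_iff.1 h with ⟨rfl, rfl⟩ | ⟨rfl, rfl⟩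
        · exact hstep i hi
        · exact (hstep i hi).symm
    · intro d hdK hd
      have hdO : ∀ i, 0 < i → i + 1 < m → d (f i) ∈ LO i := fun i hi him => by
        rw [← hKO i hi him]; exact hdK _
      -- The order matters: this half makes the extra colour of `f (m - 1)` unusable, so that the
      -- base lists determine `T`; only then is the colour of `f 0` known, which `f 1` needs.
      have hup : ∀ i, s ≤ i → i + 1 < m → d (f i) = 3 + (i : ℤ) := by
        intro i hi
        induction i, hi using Nat.le_induction with
        | base =>
          intro hm
          simpa [LO] using hdO s (by omega) hm
        | succ i hi ih =>
          intro hm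
          have h1 := ih (by omega)
          have h2 := hdO (i + 1) (by omega) hm
          have h3 := hd _ _ (hadj i (by omega))
          simp only [LO] at h2
          rw [if_neg (by omega), if_neg (by omega), if_neg (by omega), Finset.mem_insert,
            Finset.mem_singleton] at h2
          push_cast at h2 ⊢
          omega
      have hdT : ∀ v ∈ T, ∃ k ∈ B v, φ k = d v := by
        intro v hv
        have h1 := hdK v
        simp only [K, hv, if_true, Finset.mem_union, Finset.mem_image] at h1
        rcases h1 with h1 | h1
        · exact h1
        · exfalso
          split_ifs at h1 with h2
          · subst h2
            rw [Finset.mem_singleton] at h1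
            have h3 := hd _ _ (hadj (m - 2) (by omega))
            rw [hup (m - 2) (by omega) (by omega), show m - 2 + 1 = m - 1 by omega, h1] at h3
            omega
          · simp at h1
      choose! k hkB hk using hdT
      have hkC := hBuniq k hkB fun u hu v hv huv h => hd u v huv (by rw [← hk u hu, ← hk v hv, h])
      have hdC : ∀ v ∈ T, d v = φ (C v) := fun v hv => by rw [← hk v hv, hkC v hv]
      have hdown : ∀ j i, i + j = s → 2 ≤ i → d (f i) = 3 + (i : ℤ) := by
        intro j
        induction j with
        | zero =>
          intro i hi _
          exact hup i (by omega) (by omega)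
        | succ j ih =>
          intro i hi h2
          have h1 := ih (i + 1) (by omega) (by omega)
          have h2 := hdO i (by omega) (by omega)
          have h3 := hd _ _ (hadj i (by omega))
          simp only [LO] at h2
          rw [if_neg (by omega), if_neg (by omega), if_pos (by omega), Finset.mem_insert,
            Finset.mem_singleton] at h2
          push_cast at h1
          omega
      have hone : d (f 1) = 3 + ((1 : ℕ) : ℤ) := by
        have h1 := hdown (s - 2) 2 (by omega) le_rfl
        have h2 := hdO 1 (by omega) (by omega)
        have h3 := hd _ _ (hadj 1 (by omega))
        have h4 := hd _ _ (hadj 0 (by omega))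
        have h5 := hdC _ h0
        simp only [LO] at h2
        rw [if_neg (by omega), if_pos trivial, Finset.mem_insert, Finset.mem_insert,
          Finset.mem_singleton] at h2
        norm_num at h1 h3 h4 ⊢
        omega
      funext v
      rcases hcov v with hv | ⟨i, hi, him, rfl⟩
      · rw [hcT v hv, hdC v hv]
      · rw [hcO i hi him]
        rcases Nat.lt_or_ge i s with h | h
        · rcases Nat.lt_or_ge i 2 with h2 | h2
          · obtain rfl : i = 1 := by omega
            exact hone
          · exact hdown (s - i) i (by omega) h2
        · exact hup i h him
  · have h := hμO s (by omega) (by omega)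
    split_ifs at h <;> omega
  · intro v hv hvm
    rw [← hμ v, hKT v hv hvm]
  · have := hμ (f (m - 1))
    omega
  · intro v hv
    rcases hcov v with h | ⟨i, hi, him, rfl⟩
    · exact absurd h hv
    · have h := hμO i hi him
      split_ifs at h <;> omega

/-- A path attached to a 2-tree with a given 3-colouring at the ends `f 0` and `f (m - 1)` of an
edge: monomials in which `f s` and `y` have small exponents. -/
theorem exists_coeff_ne_zero_of_path [DecidableEq V] (hr : G.IsOrientation r) {T : Finset V}
    (hT : G.IsTwoTree T) (C : V → Fin 3) (hC : ∀ u ∈ T, ∀ v ∈ T, G.Adj u v → C u ≠ C v)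
    (f : ℕ → V) (m s : ℕ) (hs : 2 ≤ s) (hsm : s + 2 ≤ m)
    (hinj : ∀ i < m, ∀ j < m, f i = f j → i = j) (h0 : f 0 ∈ T) (hlast : f (m - 1) ∈ T)
    (hmid : ∀ i, 0 < i → i + 1 < m → f i ∉ T)
    (hcov : ∀ v, v ∈ T ∨ ∃ i, 0 < i ∧ i + 1 < m ∧ f i = v)
    (hadj : ∀ i, i + 1 < m → G.Adj (f i) (f (i + 1)))
    (hedge : ∀ u v, G.Adj u v → (u ∈ T ∧ v ∈ T) ∨ ∃ i, i + 1 < m ∧ s(u, v) = s(f i, f (i + 1)))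
    (hends : G.Adj (f 0) (f (m - 1))) {y : V} (hy : y ∈ T) (hy0 : y ≠ f 0)
    (hyl : y ≠ f (m - 1)) :
    ∃ μ : V →₀ ℕ, (G.graphPolynomial r).coeff μ ≠ 0 ∧ μ (f s) = 0 ∧
      μ y = (if C (f (m - 1)) = C y then 1 else 0) ∧ ∀ v, v ≠ f s → v ≠ y → μ v ≤ 2 := by
  have hCab := hC _ h0 _ hlast hends
  have hab := hends.ne
  split_ifs with hay
  · obtain ⟨e, he1, he2⟩ : ∃ e, e ≠ C y ∧ e ≠ C (f 0) := by
      generalize C y = p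
      generalize C (f 0) = q
      revert p q
      decide
    have hCby : C (f 0) ≠ C y := hay ▸ hCab
    -- Equal colours at `y` and `f (m - 1)` under `C` are equal under any proper 3-colouring, and
    -- the two lists share only `C y`. This colour is then excluded at `f 0`.
    let B : V → Finset (Fin 3) := fun v => if v = y then {C y, C (f 0)} else
      if v = f (m - 1) then {C y, e} else if v = f 0 then {C (f 0), C y} else Finset.univ
    have hBy : B y = {C y, C (f 0)} := by simp [B]
    have hBl : B (f (m - 1)) = {C y, e} := by simp [B, hyl.symm]
    have hB0 : B (f 0) = {C (f 0), C y} := by simp [B, hy0.symm, hab]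
    have hBcard : ∀ v, (B v).card + ((if y = v then 1 else 0) + (if f (m - 1) = v then 1 else 0) +
        (if f 0 = v then 1 else 0)) = 3 := by
      intro v
      by_cases h1 : v = y
      · subst h1
        rw [hBy, Finset.card_pair hCby.symm, if_pos rfl, if_neg hyl.symm, if_neg hy0.symm]
      by_cases h2 : v = f (m - 1)
      · subst h2
        rw [hBl, Finset.card_pair he1.symm, if_pos rfl, if_neg hyl, if_neg hab]
      by_cases h3 : v = f 0
      · subst h3
        rw [hB0, Finset.card_pair hCby, if_pos rfl, if_neg hy0, if_neg hab.symm]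
      · simp [B, h1, h2, h3, Ne.symm h1, Ne.symm h2, Ne.symm h3]
    obtain ⟨μ, h1, h2, h3, h4, h5⟩ := exists_coeff_ne_zero_of_isTwoTree hr hT C hC f m s hs hsm
      hinj h0 hlast hmid hcov hadj hedge B (fun v _ => by
        simp only [B]
        split_ifs with h1 h2 h3
        · simp [h1]
        · simp [h2, hay]
        · simp [h3]
        · simp)
      (fun c hcB hc => by
        have e1 := hcB _ hy
        have e2 := hcB _ hlast
        have e3 := hcB _ h0
        rw [hBy, Finset.mem_insert, Finset.mem_singleton] at e1
        rw [hBl, Finset.mem_insert, Finset.mem_singleton] at e2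
        rw [hB0, Finset.mem_insert, Finset.mem_singleton] at e3
        have e4 := (hT.eq_iff_eq_of_colouring hC hc _ hlast _ hy).1 hay
        have e5 := hc _ h0 _ hlast hends
        have e6 : c y = C y := by
          rcases e1 with e1 | e1
          · exact e1
          · rw [e4, e1] at e2
            rcases e2 with e2 | e2
            · exact absurd e2 hCby
            · exact absurd e2.symm he2
        refine hT.eq_of_colouring hC hc hy h0 hCby.symm e6 ?_
        rcases e3 with e3 | e3
        · exact e3
        · exact absurd (e3.trans (e6.symm.trans e4.symm)) e5)
      (by
        have h := Finset.sum_congr (rfl : T = T) fun v _ => hBcard v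
        rw [Finset.sum_add_distrib, Finset.sum_add_distrib, Finset.sum_add_distrib,
          Finset.sum_ite_eq, Finset.sum_ite_eq, Finset.sum_ite_eq, if_pos hy, if_pos hlast,
          if_pos h0, Finset.sum_const, smul_eq_mul] at h
        omega)
    refine ⟨μ, h1, h2, ?_, fun v _ _ => ?_⟩
    · have := h3 y hy hyl
      rw [hBy, Finset.card_pair hCby.symm] at this
      omega
    · by_cases hv : v ∈ T
      · by_cases hvl : v = f (m - 1)
        · subst hvl
          rw [h4, hBl, Finset.card_pair he1.symm]
        · have := h3 v hv hvl
          have := hBcard v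
          omega
      · exact h5 v hv
  -- Here `y` is fixed, and `f (m - 1)` cannot share its colour because it does not under `C`.
  · let B : V → Finset (Fin 3) := fun v => if v = y then {C y} else
      if v = f (m - 1) then {C (f (m - 1)), C y} else Finset.univ
    have hBy : B y = {C y} := by simp [B]
    have hBl : B (f (m - 1)) = {C (f (m - 1)), C y} := by simp [B, hyl.symm]
    have hBcard : ∀ v, (B v).card + ((if y = v then 2 else 0) +
        (if f (m - 1) = v then 1 else 0)) = 3 := by
      intro v
      by_cases h1 : v = y
      · subst h1
        rw [hBy, Finset.card_singleton, if_pos rfl, if_neg hyl.symm]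
      by_cases h2 : v = f (m - 1)
      · subst h2
        rw [hBl, Finset.card_pair hay, if_pos rfl, if_neg hyl]
      · simp [B, h1, h2, Ne.symm h1, Ne.symm h2]
    obtain ⟨μ, h1, h2, h3, h4, h5⟩ := exists_coeff_ne_zero_of_isTwoTree hr hT C hC f m s hs hsm
      hinj h0 hlast hmid hcov hadj hedge B (fun v _ => by
        simp only [B]
        split_ifs with h1 h2
        · simp [h1]
        · simp [h2]
        · simp)
      (fun c hcB hc => by
        have e1 := hcB _ hy
        have e2 := hcB _ hlast
        rw [hBy, Finset.mem_singleton] at e1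
        rw [hBl, Finset.mem_insert, Finset.mem_singleton] at e2
        refine hT.eq_of_colouring hC hc hlast hy hay ?_ e1
        rcases e2 with e2 | e2
        · exact e2
        · exact absurd ((hT.eq_iff_eq_of_colouring hC hc _ hlast _ hy).2 (e2.trans e1.symm)) hay)
      (by
        have h := Finset.sum_congr (rfl : T = T) fun v _ => hBcard v
        rw [Finset.sum_add_distrib, Finset.sum_add_distrib,
          Finset.sum_ite_eq, Finset.sum_ite_eq, if_pos hy, if_pos hlast,
          Finset.sum_const, smul_eq_mul] at h
        omega)
    refine ⟨μ, h1, h2, ?_, fun v _ _ => ?_⟩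
    · have := h3 y hy hyl
      rw [hBy, Finset.card_singleton] at this
      omega
    · by_cases hv : v ∈ T
      · by_cases hvl : v = f (m - 1)
        · subst hvl
          rw [h4, hBl, Finset.card_pair hay]
        · have := h3 v hv hvl
          have := hBcard v
          omega
      · exact h5 v hv

end SimpleGraph

/-! ### Faces and the two sides of an edge -/

theorem Finset.exists_mem_ne_ne {V : Type*} {S : Finset V} (hS : 3 ≤ S.card) (u v : V) :
    ∃ w ∈ S, w ≠ u ∧ w ≠ v := by
  classical
  have h1 := Finset.pred_card_le_card_erase (s := S) (a := u)
  have h2 := Finset.pred_card_le_card_erase (s := S.erase u) (a := v)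
  obtain ⟨w, hw⟩ := Finset.card_pos.1 (show 0 < ((S.erase u).erase v).card by omega)
  simp only [Finset.mem_erase] at hw
  exact ⟨w, hw.2.2, hw.2.1, hw.1⟩

namespace OuterplaneDrawing

variable {V : Type*} [Fintype V] {G : SimpleGraph V} (D : OuterplaneDrawing G)

/-- All vertices of `S` other than `u` and `v` lie on the same side of the chord `uv`, namely on
the open arc described by `OnArc` if `s` holds, and on the other open arc if not. -/
def Within (u v : V) (s : Prop) (S : Finset V) : Prop :=
  ∀ w ∈ S, w ≠ u → w ≠ v → (D.OnArc u v w ↔ s)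

variable {D}

theorem onArc_comm {u v w : V} : D.OnArc u v w ↔ D.OnArc v u w := or_comm

theorem Within.symm {u v : V} {s : Prop} {S : Finset V} (h : D.Within u v s S) :
    D.Within v u s S := fun w hw hv hu => onArc_comm.trans (h w hw hu hv)

theorem Within.congr {u v : V} {s t : Prop} {S : Finset V} (h : D.Within u v s S) (hst : s ↔ t) :
    D.Within u v t S := fun w hw hu hv => (h w hw hu hv).trans hst

theorem Within.eq_or_eq {u v w : V} {s : Prop} {S S' : Finset V} (h : D.Within u v s S)
    (h' : D.Within u v (¬ s) S') (hw : w ∈ S) (hw' : w ∈ S') : w = u ∨ w = v := by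
  by_contra! hne
  have h1 := h w hw hne.1 hne.2
  have h2 := h' w hw' hne.1 hne.2
  tauto

theorem pos_val_ne {u v : V} (h : u ≠ v) : (D.pos u : ℕ) ≠ D.pos v := fun h' =>
  h (D.pos.injective (Fin.ext h'))

/-- The crossing condition prescribes which chord starts first and the order of the ends, so all
eight labellings enter. -/
theorem onArc_iff_of_adj {u v c d : V} (huv : G.Adj u v) (hcd : G.Adj c d) (hcu : c ≠ u)
    (hcv : c ≠ v) (hdu : d ≠ u) (hdv : d ≠ v) : D.OnArc u v c ↔ D.OnArc u v d := by
  have h1 := D.noncrossing u v c d huv hcd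
  have h2 := D.noncrossing u v d c huv hcd.symm
  have h3 := D.noncrossing v u c d huv.symm hcd
  have h4 := D.noncrossing v u d c huv.symm hcd.symm
  have h5 := D.noncrossing c d u v hcd huv
  have h6 := D.noncrossing d c u v hcd.symm huv
  have h7 := D.noncrossing c d v u hcd huv.symm
  have h8 := D.noncrossing d c v u hcd.symm huv.symm
  have h9 := pos_val_ne (D := D) hcu
  have h10 := pos_val_ne (D := D) hcv
  have h11 := pos_val_ne (D := D) hdu
  have h12 := pos_val_ne (D := D) hdv
  simp only [OnArc, Fin.lt_def] at *
  omega

theorem IsInnerFace.within_of_mem {S : Finset V} (hS : D.IsInnerFace S) {u v : V} (huv : G.Adj u v)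
    (hu : u ∈ S) (hv : v ∈ S) : ∃ s, D.Within u v s S := by
  rcases (hS.2 u hu v hv huv.ne).1 huv with h | h
  · exact ⟨False, fun w hw _ _ => iff_false_intro (h w hw)⟩
  · exact ⟨True, fun w hw h1 h2 => iff_true_intro (h w hw h1 h2)⟩

/-- A gap between consecutive vertices of a face: a vertex outside a face is cut off from it by a
side of the face. -/
theorem IsInnerFace.exists_side_of_notMem {S : Finset V} (hS : D.IsInnerFace S) {z : V}
    (hz : z ∉ S) : ∃ u ∈ S, ∃ v ∈ S, G.Adj u v ∧ ∃ s, D.Within u v s S ∧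
      (D.OnArc u v z ↔ ¬ s) := by
  have hne : S.Nonempty := Finset.card_pos.1 (by have := hS.1; omega)
  have hzS : ∀ w ∈ S, (D.pos w : ℕ) ≠ D.pos z := fun w hw =>
    pos_val_ne (D := D) fun h => hz (h ▸ hw)
  -- If `S` has vertices numbered both below and above `z`, the nearest ones bound the gap;
  -- otherwise the gap contains the starting point of the numbering and is bounded by the first and
  -- last vertices of `S`.
  by_cases hlt : (S.filter fun w => D.pos w < D.pos z).Nonempty ∧
      (S.filter fun w => D.pos z < D.pos w).Nonempty
  · obtain ⟨u, hu, humax⟩ := Finset.exists_max_image _ D.pos hlt.1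
    obtain ⟨v, hv, hvmin⟩ := Finset.exists_min_image _ D.pos hlt.2
    simp only [Finset.mem_filter, and_imp, Fin.lt_def, Fin.le_def] at hu hv humax hvmin
    have hno : ∀ w ∈ S, ¬ D.OnArc u v w := by
      intro w hw
      have h1 := humax w hw
      have h2 := hvmin w hw
      have h3 := hzS w hw
      simp only [OnArc, Fin.lt_def]
      omega
    have hnuv : u ≠ v := by rintro rfl; omega
    refine ⟨u, hu.1, v, hv.1, (hS.2 u hu.1 v hv.1 hnuv).2 (Or.inl hno), False,
      fun w hw _ _ => iff_false_intro (hno w hw), ?_⟩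
    simp only [OnArc, Fin.lt_def, not_false_iff, iff_true]
    omega
  · obtain ⟨u, hu, humin⟩ := Finset.exists_min_image S D.pos hne
    obtain ⟨v, hv, hvmax⟩ := Finset.exists_max_image S D.pos hne
    simp only [Fin.le_def] at humin hvmax
    have hall : ∀ w ∈ S, w ≠ u → w ≠ v → D.OnArc u v w := by
      intro w hw h1 h2
      have h1 := pos_val_ne (D := D) h1
      have h2 := pos_val_ne (D := D) h2
      have h3 := humin w hw
      have h4 := hvmax w hw
      simp only [OnArc, Fin.lt_def]
      omega
    have hnuv : u ≠ v := by
      rintro rfl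
      obtain ⟨w, hw, hwu, -⟩ := Finset.exists_mem_ne_ne hS.1 u u
      have h1 := pos_val_ne (D := D) hwu
      have h3 := humin w hw
      have h4 := hvmax w hw
      omega
    refine ⟨u, hu, v, hv, (hS.2 u hu v hv hnuv).2 (Or.inr hall), True,
      fun w hw h1 h2 => iff_true_intro (hall w hw h1 h2), ?_⟩
    have h3 := hvmax u hu
    simp only [OnArc, Fin.lt_def, not_true, iff_false]
    intro h
    refine hlt ⟨⟨u, ?_⟩, ⟨v, ?_⟩⟩ <;> simp only [Finset.mem_filter, Fin.lt_def]
    · exact ⟨hu, by omega⟩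
    · exact ⟨hv, by omega⟩

/-- A face lies on one side of each edge. -/
theorem IsInnerFace.exists_within {S : Finset V} (hS : D.IsInnerFace S) {u v : V}
    (huv : G.Adj u v) : ∃ s, D.Within u v s S := by
  wlog hlt : (D.pos u : ℕ) < D.pos v generalizing u v
  · have hne := pos_val_ne (D := D) huv.ne
    obtain ⟨s, hs⟩ := this huv.symm (by omega)
    exact ⟨s, hs.symm⟩
  by_cases huvS : u ∈ S ∧ v ∈ S
  · exact hS.within_of_mem huv huvS.1 huvS.2
  by_contra! hcon
  have hin : (S.filter fun w => D.pos u < D.pos w ∧ D.pos w < D.pos v).Nonempty := by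
    by_contra! h
    refine hcon False fun w hw _ _ => iff_false_intro fun h' => ?_
    have : w ∈ S.filter fun w => D.pos u < D.pos w ∧ D.pos w < D.pos v := by
      simp only [OnArc, Fin.lt_def] at h'
      simp only [Finset.mem_filter, Fin.lt_def]
      exact ⟨hw, by omega, by omega⟩
    simp [h] at this
  obtain ⟨d, hd, hdu, hdv, hdarc⟩ : ∃ d ∈ S, d ≠ u ∧ d ≠ v ∧ ¬ D.OnArc u v d := by
    by_contra! h
    exact hcon True fun w hw h1 h2 => iff_true_intro (h w hw h1 h2)
  have hdu := pos_val_ne (D := D) hdu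
  have hdv := pos_val_ne (D := D) hdv
  simp only [OnArc, Fin.lt_def] at hdarc
  -- A polygon meeting both open arcs has a side jumping from one to the other, which crosses `uv`.
  -- The side is taken around an end of `uv` that is not in `S`, so that it avoids both `u` and `v`.
  suffices h : ∃ c ∈ S, ∃ e ∈ S, D.IsSide S c e ∧ ((D.pos u : ℕ) < D.pos c ∧
      (D.pos c : ℕ) < D.pos v) ∧ ((D.pos e : ℕ) < D.pos u ∨ (D.pos v : ℕ) < D.pos e) by
    obtain ⟨c, hc, e, he, hside, hcuv, heuv⟩ := h
    have hne : ∀ {p q : V}, (D.pos p : ℕ) ≠ D.pos q → p ≠ q := fun h h' => h (by rw [h'])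
    have hce : G.Adj c e := (hS.2 c hc e he (hne (by omega))).2 hside
    have := (onArc_iff_of_adj (D := D) huv hce (hne (by omega)) (hne (by omega))
      (hne (by omega)) (hne (by omega))).1 (Or.inl (by simpa only [Fin.lt_def] using hcuv))
    simp only [OnArc, Fin.lt_def] at this
    omega
  have hSu : u ∉ S → ∀ w ∈ S, (D.pos w : ℕ) ≠ D.pos u := fun hu w hw =>
    pos_val_ne (D := D) fun h => hu (h ▸ hw)
  have hSv : v ∉ S → ∀ w ∈ S, (D.pos w : ℕ) ≠ D.pos v := fun hu w hw =>
    pos_val_ne (D := D) fun h => hu (h ▸ hw)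
  have hpos : ∀ {p q : V}, p ≠ q → (D.pos p : ℕ) ≠ D.pos q := fun h => pos_val_ne (D := D) h
  by_cases hu : u ∈ S
  · have hSv := hSv fun hv => huvS ⟨hu, hv⟩
    obtain ⟨c, hc, hcmax⟩ := Finset.exists_max_image _ D.pos hin
    simp only [Finset.mem_filter, and_imp, Fin.lt_def, Fin.le_def] at hc hcmax
    by_cases hout : (S.filter fun w => D.pos v < D.pos w).Nonempty
    · obtain ⟨e, he, hemin⟩ := Finset.exists_min_image _ D.pos hout
      simp only [Finset.mem_filter, and_imp, Fin.lt_def, Fin.le_def] at he hemin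
      refine ⟨c, hc.1, e, he.1, Or.inl fun w hw => ?_, hc.2, Or.inr he.2⟩
      have h1 := hcmax w hw
      have h2 := hemin w hw
      have h3 := hSv w hw
      simp only [OnArc, Fin.lt_def]
      omega
    · obtain ⟨e, he, hemin⟩ := Finset.exists_min_image S D.pos ⟨u, hu⟩
      simp only [Fin.le_def] at hemin
      have hnot : ∀ w ∈ S, ¬ (D.pos v : ℕ) < D.pos w := fun w hw h =>
        hout ⟨w, by simp only [Finset.mem_filter, Fin.lt_def]; exact ⟨hw, h⟩⟩
      refine ⟨c, hc.1, e, he, Or.inr fun w hw hwc hwe => ?_, hc.2, Or.inl ?_⟩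
      · have h1 := hcmax w hw
        have h2 := hemin w hw
        have h3 := hSv w hw
        have h4 := hnot w hw
        have h5 := hpos hwc
        have h6 := hpos hwe
        simp only [OnArc, Fin.lt_def]
        omega
      · have := hemin d hd
        have := hnot d hd
        omega
  · have hSu := hSu hu
    obtain ⟨c, hc, hcmin⟩ := Finset.exists_min_image _ D.pos hin
    simp only [Finset.mem_filter, and_imp, Fin.lt_def, Fin.le_def] at hc hcmin
    by_cases hout : (S.filter fun w => D.pos w < D.pos u).Nonempty
    · obtain ⟨e, he, hemax⟩ := Finset.exists_max_image _ D.pos hout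
      simp only [Finset.mem_filter, and_imp, Fin.lt_def, Fin.le_def] at he hemax
      refine ⟨c, hc.1, e, he.1, Or.inl fun w hw => ?_, hc.2, Or.inl he.2⟩
      have h1 := hcmin w hw
      have h2 := hemax w hw
      have h3 := hSu w hw
      simp only [OnArc, Fin.lt_def]
      omega
    · obtain ⟨e, he, hemax⟩ := Finset.exists_max_image S D.pos ⟨d, hd⟩
      simp only [Fin.le_def] at hemax
      have hnot : ∀ w ∈ S, ¬ (D.pos w : ℕ) < D.pos u := fun w hw h =>
        hout ⟨w, by simp only [Finset.mem_filter, Fin.lt_def]; exact ⟨hw, h⟩⟩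
      refine ⟨c, hc.1, e, he, Or.inr fun w hw hwc hwe => ?_, hc.2, Or.inr ?_⟩
      · have h1 := hcmin w hw
        have h2 := hemax w hw
        have h3 := hSu w hw
        have h4 := hnot w hw
        have h5 := hpos hwc
        have h6 := hpos hwe
        simp only [OnArc, Fin.lt_def]
        omega
      · have := hemax d hd
        have := hnot d hd
        omega

/-- A vertex of `S` outside `S'` would be separated from the rest of `S'` by a side of `S'`, while
`S` lies on one side of that edge. -/
theorem IsInnerFace.eq_of_subset {S S' : Finset V} (hS : D.IsInnerFace S) (hS' : D.IsInnerFace S')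
    (h : S' ⊆ S) : S = S' := by
  by_contra hne
  obtain ⟨z, hz, hz'⟩ : ∃ z ∈ S, z ∉ S' := by
    by_contra! h'
    exact hne (Finset.Subset.antisymm h' h)
  obtain ⟨u, hu, v, hv, huv, s, hs, hzs⟩ := hS'.exists_side_of_notMem hz'
  obtain ⟨t, ht⟩ := hS.exists_within huv
  have h1 := ht z hz (fun h => hz' (h ▸ hu)) (fun h => hz' (h ▸ hv))
  obtain ⟨w, hw, hwu, hwv⟩ := Finset.exists_mem_ne_ne hS'.1 u v
  have h2 := hs w hw hwu hwv
  have h3 := ht w (h hw) hwu hwv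
  tauto

/-- Two different faces are separated by a side of the first one. -/
theorem IsInnerFace.exists_separating_side {S S' : Finset V} (hS : D.IsInnerFace S)
    (hS' : D.IsInnerFace S') (hne : S ≠ S') : ∃ u ∈ S, ∃ v ∈ S, G.Adj u v ∧
      ∃ s, D.Within u v s S ∧ D.Within u v (¬ s) S' := by
  obtain ⟨z, hz', hz⟩ : ∃ z ∈ S', z ∉ S := by
    by_contra! h
    exact hne (hS.eq_of_subset hS' h)
  obtain ⟨u, hu, v, hv, huv, s, hs, hzs⟩ := hS.exists_side_of_notMem hz
  obtain ⟨t, ht⟩ := hS'.exists_within huv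
  have h1 := ht z hz' (fun h => hz (h ▸ hu)) (fun h => hz (h ▸ hv))
  exact ⟨u, hu, v, hv, huv, s, hs, ht.congr (h1.symm.trans hzs)⟩

/-- Two different faces with two common vertices lie on different sides of a common edge. -/
theorem IsInnerFace.opposite {S S' : Finset V} (hS : D.IsInnerFace S)
    (hS' : D.IsInnerFace S') (hne : S ≠ S') {u v : V} (huv : u ≠ v) (hu : u ∈ S) (hu' : u ∈ S')
    (hv : v ∈ S) (hv' : v ∈ S') :
    G.Adj u v ∧ ∃ s, D.Within u v s S ∧ D.Within u v (¬ s) S' := by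
  obtain ⟨p, hp, q, hq, hpq, s, hs, hs'⟩ := hS.exists_separating_side hS' hne
  rcases hs.eq_or_eq hs' hu hu' with rfl | rfl <;> rcases hs.eq_or_eq hs' hv hv' with rfl | rfl
  · exact absurd rfl huv
  · exact ⟨hpq, s, hs, hs'⟩
  · exact ⟨hpq.symm, s, hs.symm, hs'.symm⟩
  · exact absurd rfl huv

/-- Different faces would lie on opposite sides by `opposite`; thus an edge bounds at most one face
on each side. -/
theorem IsInnerFace.eq_of_within {S S' : Finset V} (hS : D.IsInnerFace S)
    (hS' : D.IsInnerFace S') {u v : V} (huv : u ≠ v) (hu : u ∈ S) (hu' : u ∈ S')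
    (hv : v ∈ S) (hv' : v ∈ S') {s : Prop} (hs : D.Within u v s S) (hs' : D.Within u v s S') :
    S = S' := by
  by_contra hne
  obtain ⟨-, t, ht, ht'⟩ := hS.opposite hS' hne huv hu hu' hv hv'
  obtain ⟨w, hw, h1, h2⟩ := Finset.exists_mem_ne_ne hS.1 u v
  obtain ⟨w', hw', h1', h2'⟩ := Finset.exists_mem_ne_ne hS'.1 u v
  have h3 := hs w hw h1 h2
  have h4 := ht w hw h1 h2
  have h5 := hs' w' hw' h1' h2'
  have h6 := ht' w' hw' h1' h2'
  tauto

/-- If two faces on different sides of `uv` have two common vertices, these are `u` and `v`. -/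
theorem Within.ends_mem {u v : V} {s : Prop} {S S' : Finset V} (h : D.Within u v s S)
    (h' : D.Within u v (¬ s) S') {p q : V} (hpq : p ≠ q) (hp : p ∈ S) (hp' : p ∈ S')
    (hq : q ∈ S) (hq' : q ∈ S') : (u ∈ S ∧ v ∈ S) ∧ (u ∈ S' ∧ v ∈ S') := by
  rcases h.eq_or_eq h' hp hp' with rfl | rfl <;> rcases h.eq_or_eq h' hq hq' with rfl | rfl
  · exact absurd rfl hpq
  · exact ⟨⟨hp, hq⟩, hp', hq'⟩
  · exact ⟨⟨hq, hp⟩, hq', hp'⟩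
  · exact absurd rfl hpq

theorem IsInnerFace.adj_of_card_eq_three {S : Finset V} (hS : D.IsInnerFace S) (h3 : S.card = 3)
    {u v : V} (hu : u ∈ S) (hv : v ∈ S) (huv : u ≠ v) : G.Adj u v := by
  classical
  obtain ⟨w, hw, hwu, hwv⟩ := Finset.exists_mem_ne_ne hS.1 u v
  have hS3 : S = {u, v, w} := by
    refine (Finset.eq_of_subset_of_card_le ?_ ?_).symm
    · intro z
      simp only [Finset.mem_insert, Finset.mem_singleton]
      rintro (rfl | rfl | rfl) <;> assumption
    · rw [h3, Finset.card_eq_three.2 ⟨u, v, w, huv, hwu.symm, hwv.symm, rfl⟩]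
  refine (hS.2 u hu v hv huv).2 ?_
  by_cases h : D.OnArc u v w
  · refine Or.inr fun z hz h1 h2 => ?_
    rw [hS3] at hz
    simp only [Finset.mem_insert, Finset.mem_singleton] at hz
    rcases hz with rfl | rfl | rfl
    exacts [absurd rfl h1, absurd rfl h2, h]
  · refine Or.inl fun z hz => ?_
    rw [hS3] at hz
    simp only [Finset.mem_insert, Finset.mem_singleton] at hz
    rcases hz with rfl | rfl | rfl
    · simp [OnArc]
    · simp [OnArc]
    · exact h

end OuterplaneDrawing

/-! ### The boundary of a face in cyclic order -/

namespace OuterplaneDrawing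

variable {V : Type*} [Fintype V] {G : SimpleGraph V} (D : OuterplaneDrawing G)

/-- The number of steps along the circle from `c` to `w`. -/
def cyclicPos (c w : V) : ℕ :=
  if (D.pos c : ℕ) ≤ D.pos w then D.pos w - D.pos c else D.pos w + Fintype.card V - D.pos c

variable {D}

theorem cyclicPos_self (c : V) : D.cyclicPos c c = 0 := by simp [cyclicPos]

theorem cyclicPos_injective (c : V) : Function.Injective (D.cyclicPos c) := by
  intro u v h
  by_contra hne
  have := pos_val_ne (D := D) hne
  have h1 := (D.pos u).2
  have h2 := (D.pos v).2
  have h3 := (D.pos c).2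
  simp only [cyclicPos] at h
  split_ifs at h <;> omega

/-- Restarting the numbering at `c` either keeps the arc between `u` and `v` or exchanges it with
the complementary one, and being a side is symmetric in the two arcs. -/
theorem isSide_iff_cyclicPos (c : V) {S : Finset V} {u v : V}
    (huv : D.cyclicPos c u < D.cyclicPos c v) :
    D.IsSide S u v ↔
      (∀ w ∈ S, ¬ (D.cyclicPos c u < D.cyclicPos c w ∧ D.cyclicPos c w < D.cyclicPos c v)) ∨
      (∀ w ∈ S, w ≠ u → w ≠ v →
        D.cyclicPos c u < D.cyclicPos c w ∧ D.cyclicPos c w < D.cyclicPos c v) := by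
  have h1 := (D.pos u).2
  have h2 := (D.pos v).2
  have h3 := (D.pos c).2
  have hself : ∀ p q : V, ¬ D.OnArc p q p ∧ ¬ D.OnArc p q q := fun p q => by simp [OnArc]
  rcases Nat.lt_or_ge (D.pos u) (D.pos v) with hlt | hge
  · have key : ∀ w, (D.cyclicPos c u < D.cyclicPos c w ∧ D.cyclicPos c w < D.cyclicPos c v) ↔
        D.OnArc u v w := by
      intro w
      have h4 := (D.pos w).2
      simp only [cyclicPos, OnArc, Fin.lt_def] at *
      split_ifs at huv ⊢ <;> omega
    simp only [key, IsSide]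
  · have key : ∀ w, w ≠ u → w ≠ v →
        ((D.cyclicPos c u < D.cyclicPos c w ∧ D.cyclicPos c w < D.cyclicPos c v) ↔
        ¬ D.OnArc u v w) := by
      intro w hwu hwv
      have h4 := (D.pos w).2
      have h5 := pos_val_ne (D := D) hwu
      have h6 := pos_val_ne (D := D) hwv
      simp only [cyclicPos, OnArc, Fin.lt_def] at *
      split_ifs at huv ⊢ <;> omega
    constructor
    · rintro (h | h)
      · exact Or.inr fun w hw hwu hwv => (key w hwu hwv).2 (h w hw)
      · refine Or.inl fun w hw hw' => ?_
        have hwu : w ≠ u := by rintro rfl; omega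
        have hwv : w ≠ v := by rintro rfl; omega
        exact (key w hwu hwv).1 hw' (h w hw hwu hwv)
    · rintro (h | h)
      · refine Or.inr fun w hw hwu hwv => ?_
        by_contra h'
        exact h w hw ((key w hwu hwv).2 h')
      · refine Or.inl fun w hw hw' => ?_
        have hwu : w ≠ u := by rintro rfl; exact (hself _ _).1 hw'
        have hwv : w ≠ v := by rintro rfl; exact (hself _ _).2 hw'
        exact (key w hwu hwv).1 (h w hw hwu hwv) hw'

/-- The vertices of a face in cyclic order, starting at `c`. -/
theorem IsInnerFace.exists_cycle {N : Finset V} (hN : D.IsInnerFace N) {c : V} (hc : c ∈ N) :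
    ∃ f : ℕ → V, f 0 = c ∧ (∀ i < N.card, ∀ j < N.card, f i = f j → i = j) ∧
      (∀ i < N.card, f i ∈ N) ∧ (∀ v ∈ N, ∃ i < N.card, f i = v) ∧
      ∀ i j, i < j → j < N.card → (G.Adj (f i) (f j) ↔ j = i + 1 ∨ (i = 0 ∧ j + 1 = N.card)) := by
  classical
  have hinjκ := cyclicPos_injective (D := D) c
  have hcard : (N.image (D.cyclicPos c)).card = N.card := Finset.card_image_of_injective _ hinjκ
  have h3 := hN.1
  let e := (N.image (D.cyclicPos c)).orderEmbOfFin hcard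
  have he : ∀ i : ℕ, ∃ v, ∀ hi : i < N.card, v ∈ N ∧ D.cyclicPos c v = e ⟨i, hi⟩ := by
    intro i
    by_cases hi : i < N.card
    · obtain ⟨v, hv, hv'⟩ := Finset.mem_image.1
        ((N.image (D.cyclicPos c)).orderEmbOfFin_mem hcard ⟨i, hi⟩)
      exact ⟨v, fun _ => ⟨hv, hv'⟩⟩
    · exact ⟨c, fun h => absurd h hi⟩
  choose f hf using he
  have hmono : ∀ i j, i < j → j < N.card → D.cyclicPos c (f i) < D.cyclicPos c (f j) := by
    intro i j hij hj
    rw [(hf i (hij.trans hj)).2, (hf j hj).2]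
    exact e.strictMono hij
  have hsurj : ∀ v ∈ N, ∃ i < N.card, f i = v := by
    intro v hv
    have hr := (N.image (D.cyclicPos c)).range_orderEmbOfFin hcard
    have hv' : D.cyclicPos c v ∈ Set.range e := by
      rw [hr]
      exact Finset.mem_coe.2 (Finset.mem_image_of_mem _ hv)
    obtain ⟨i, hi⟩ := hv'
    exact ⟨i, i.2, hinjκ ((hf i i.2).2.trans hi)⟩
  have hinj : ∀ i < N.card, ∀ j < N.card, f i = f j → i = j := by
    intro i hi j hj hij
    rcases lt_trichotomy i j with h | h | h
    · have := hmono i j h hj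
      rw [hij] at this
      omega
    · exact h
    · have := hmono j i h hi
      rw [hij] at this
      omega
  have hlt : ∀ i < N.card, ∀ j < N.card,
      (D.cyclicPos c (f i) < D.cyclicPos c (f j) ↔ i < j) := by
    intro i hi j hj
    refine ⟨fun h => ?_, fun h => hmono i j h hj⟩
    by_contra h'
    rcases Nat.eq_or_lt_of_le (not_lt.1 h') with h1 | h1
    · subst h1; omega
    · have := hmono j i h1 hi
      omega
  refine ⟨f, ?_, hinj, fun i hi => (hf i hi).1, hsurj, ?_⟩
  · obtain ⟨i, hi, hic⟩ := hsurj c hc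
    rcases Nat.eq_zero_or_pos i with rfl | hpos
    · exact hic
    · have := hmono 0 i hpos hi
      rw [hic, cyclicPos_self] at this
      omega
  · intro i j hij hj
    rw [hN.2 _ (hf i (hij.trans hj)).1 _ (hf j hj).1 fun h =>
      hij.ne (hinj i (hij.trans hj) j hj h), isSide_iff_cyclicPos c (hmono i j hij hj)]
    constructor
    · rintro (h | h)
      · left
        by_contra hne
        exact h (f (i + 1)) (hf (i + 1) (by omega)).1
          ⟨hmono _ _ (by omega) (by omega), hmono _ _ (by omega) hj⟩
      · right
        have h' : ∀ l < N.card, l ≠ i → l ≠ j → i < l ∧ l < j := by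
          intro l hl hli hlj
          have := h (f l) (hf l hl).1 (fun h => hli (hinj l hl i (by omega) h))
            (fun h => hlj (hinj l hl j hj h))
          rwa [hlt i (by omega) l hl, hlt l hl j hj] at this
        constructor
        · by_contra h0
          have := h' 0 (by omega) (by omega) (by omega)
          omega
        · by_contra h0
          have := h' (N.card - 1) (by omega) (by omega) (by omega)
          omega
    · rintro (h | ⟨h, h'⟩)
      · left
        intro w hw hw'
        obtain ⟨l, hl, rfl⟩ := hsurj w hw
        rw [hlt i (by omega) l hl, hlt l hl j hj] at hw'
        omega
      · right
        intro w hw hwi hwj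
        obtain ⟨l, hl, rfl⟩ := hsurj w hw
        rw [hlt i (by omega) l hl, hlt l hl j hj]
        have h1 : l ≠ i := by rintro rfl; exact hwi rfl
        have h2 : l ≠ j := by rintro rfl; exact hwj rfl
        omega

/-- The boundary of a face minus the edge `ab` is a path from `b` to `a`. -/
theorem IsInnerFace.exists_path {N : Finset V} (hN : D.IsInnerFace N) {a b : V} (ha : a ∈ N)
    (hb : b ∈ N) (hab : G.Adj a b) :
    ∃ f : ℕ → V, f 0 = b ∧ f (N.card - 1) = a ∧
      (∀ i < N.card, ∀ j < N.card, f i = f j → i = j) ∧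
      (∀ i < N.card, f i ∈ N) ∧ (∀ v ∈ N, ∃ i < N.card, f i = v) ∧
      (∀ i, i + 1 < N.card → G.Adj (f i) (f (i + 1))) ∧
      ∀ u ∈ N, ∀ v ∈ N, G.Adj u v →
        s(u, v) = s(a, b) ∨ ∃ i, i + 1 < N.card ∧ s(u, v) = s(f i, f (i + 1)) := by
  obtain ⟨f, h0, hinj, hmem, hsurj, hadj⟩ := hN.exists_cycle ha
  have h3 := hN.1
  have hedge : ∀ u ∈ N, ∀ v ∈ N, G.Adj u v → s(u, v) = s(f 0, f (N.card - 1)) ∨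
      ∃ i, i + 1 < N.card ∧ s(u, v) = s(f i, f (i + 1)) := by
    intro u hu v hv huv
    obtain ⟨i, hi, rfl⟩ := hsurj u hu
    obtain ⟨j, hj, rfl⟩ := hsurj v hv
    have hij : i ≠ j := by rintro rfl; exact huv.ne rfl
    rcases Nat.lt_or_gt_of_ne hij with h | h
    · rcases (hadj i j h hj).1 huv with rfl | ⟨rfl, h'⟩
      · exact Or.inr ⟨i, hj, rfl⟩
      · obtain rfl : j = N.card - 1 := by omega
        exact Or.inl rfl
    · rcases (hadj j i h hi).1 huv.symm with rfl | ⟨rfl, h'⟩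
      · exact Or.inr ⟨j, hi, Sym2.eq_swap⟩
      · obtain rfl : i = N.card - 1 := by omega
        exact Or.inl Sym2.eq_swap
  obtain ⟨j, hj, hjb⟩ := hsurj b hb
  have hj0 : 0 < j := by
    rcases Nat.eq_zero_or_pos j with rfl | h
    · exact absurd (h0.symm.trans hjb) hab.ne
    · exact h
  -- In the cycle starting at `a`, the neighbour `b` is second or last: the cycle is shifted by one
  -- in the first case and reversed in the other.
  rcases (hadj 0 j hj0 hj).1 (by rw [h0, hjb]; exact hab) with rfl | ⟨-, hjl⟩
  · let g : ℕ → V := fun i => if i + 1 < N.card then f (i + 1) else f 0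
    have hg : ∀ i, i + 1 < N.card → g i = f (i + 1) := fun i hi => if_pos hi
    have hgl : g (N.card - 1) = f 0 := if_neg (by omega)
    have hcases : ∀ i < N.card, i + 1 < N.card ∨ i = N.card - 1 := fun i hi => by omega
    refine ⟨g, ?_, ?_, ?_, ?_, ?_, ?_, ?_⟩
    · rw [hg 0 (by omega)]; exact hjb
    · rw [hgl, h0]
    · intro p hp q hq hpq
      rcases hcases p hp with h1 | rfl <;> rcases hcases q hq with h2 | rfl
      · rw [hg p h1, hg q h2] at hpq
        have := hinj _ h1 _ h2 hpq
        omega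
      · rw [hg p h1, hgl] at hpq
        have := hinj _ h1 _ (by omega) hpq
        omega
      · rw [hg q h2, hgl] at hpq
        have := hinj _ (by omega) _ h2 hpq
        omega
      · rfl
    · intro i hi
      rcases hcases i hi with h1 | rfl
      · rw [hg i h1]; exact hmem _ h1
      · rw [hgl]; exact hmem _ (by omega)
    · intro v hv
      obtain ⟨i, hi, rfl⟩ := hsurj v hv
      rcases Nat.eq_zero_or_pos i with rfl | h
      · exact ⟨N.card - 1, by omega, hgl⟩
      · exact ⟨i - 1, by omega, by rw [hg (i - 1) (by omega), Nat.sub_add_cancel h]⟩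
    · intro i hi
      rw [hg i hi]
      rcases hcases (i + 1) hi with h1 | h1
      · rw [hg _ h1, hadj _ _ (by omega) h1]
        exact Or.inl rfl
      · rw [h1, hgl, G.adj_comm, hadj _ _ (by omega) (by omega)]
        exact Or.inr ⟨rfl, by omega⟩
    · intro u hu v hv huv
      rcases hedge u hu v hv huv with h | ⟨i, hi, h⟩
      · refine Or.inr ⟨N.card - 2, by omega, ?_⟩
        rw [hg _ (by omega), show N.card - 2 + 1 = N.card - 1 by omega, hgl, h, Sym2.eq_swap]
      · rcases Nat.eq_zero_or_pos i with rfl | hpos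
        · left
          rw [h, h0, ← hjb]
        · refine Or.inr ⟨i - 1, by omega, ?_⟩
          rw [hg _ (by omega), hg _ (by omega), Nat.sub_add_cancel hpos, h]
  · obtain rfl : j = N.card - 1 := by omega
    refine ⟨fun i => f (N.card - 1 - i), ?_, ?_, ?_, ?_, ?_, ?_, ?_⟩
    · simpa using hjb
    · simpa using h0
    · intro p hp q hq hpq
      have := hinj _ (by omega) _ (by omega) hpq
      omega
    · exact fun i hi => hmem _ (by omega)
    · intro v hv
      obtain ⟨i, hi, rfl⟩ := hsurj v hv
      exact ⟨N.card - 1 - i, by omega, by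
        simp only
        congr 1
        omega⟩
    · intro i hi
      simp only
      rw [G.adj_comm, hadj _ _ (by omega) (by omega)]
      left
      omega
    · intro u hu v hv huv
      rcases hedge u hu v hv huv with h | ⟨i, hi, h⟩
      · left
        rw [h, h0, hjb]
      · refine Or.inr ⟨N.card - 2 - i, by omega, ?_⟩
        simp only
        rw [h, Sym2.eq_swap]
        congr 3 <;> omega

/-! ### Chains of faces -/

variable (D) in
/-- A chain of faces `S 0, …, S k`: the edge with ends `p i` and `q i` is common to `S i` and
`S (i + 1)`, and separates `S 0, …, S i` from `S (i + 1), …, S k`. -/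
structure IsFaceChain (k : ℕ) (S : ℕ → Finset V) (p q : ℕ → V) (s : ℕ → Prop) : Prop where
  face : ∀ i ≤ k, D.IsInnerFace (S i)
  adj : ∀ i < k, G.Adj (p i) (q i)
  left_mem : ∀ i < k, p i ∈ S i ∧ q i ∈ S i
  right_mem : ∀ i < k, p i ∈ S (i + 1) ∧ q i ∈ S (i + 1)
  within_le : ∀ i < k, ∀ j ≤ i, D.Within (p i) (q i) (s i) (S j)
  within_gt : ∀ i < k, ∀ j ≤ k, i < j → D.Within (p i) (q i) (¬ s i) (S j)

variable {k : ℕ} {S : ℕ → Finset V} {p q : ℕ → V} {s : ℕ → Prop}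

/-- Pairwise different faces, consecutive ones having two common vertices, form a chain. -/
theorem exists_isFaceChain (hface : ∀ i ≤ k, D.IsInnerFace (S i))
    (hinj : ∀ i ≤ k, ∀ j ≤ k, S i = S j → i = j)
    (hcom : ∀ i < k, ∃ u v, u ≠ v ∧ (u ∈ S i ∧ v ∈ S i) ∧ (u ∈ S (i + 1) ∧ v ∈ S (i + 1))) :
    ∃ p q s, D.IsFaceChain k S p q s := by
  have h1 : ∀ i, ∃ u v : V, ∃ t : Prop, i < k → G.Adj u v ∧ (u ∈ S i ∧ v ∈ S i) ∧
      (u ∈ S (i + 1) ∧ v ∈ S (i + 1)) ∧ D.Within u v t (S i) ∧ D.Within u v (¬ t) (S (i + 1)) := by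
    intro i
    by_cases hi : i < k
    · obtain ⟨u, v, huv, hl, hr⟩ := hcom i hi
      obtain ⟨hadj, t, ht, ht'⟩ := (hface i hi.le).opposite (hface (i + 1) hi)
        (fun h => by have := hinj i hi.le (i + 1) hi h; omega) huv hl.1 hr.1 hl.2 hr.2
      exact ⟨u, v, t, fun _ => ⟨hadj, hl, hr, ht, ht'⟩⟩
    · obtain ⟨u, hu⟩ := Finset.card_pos.1 (show 0 < (S 0).card by
        have := (hface 0 (Nat.zero_le k)).1
        omega)
      exact ⟨u, u, True, fun h => absurd h hi⟩
  choose p q s h using h1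
  refine ⟨p, q, s, hface, fun i hi => (h i hi).1, fun i hi => (h i hi).2.1,
    fun i hi => (h i hi).2.2.1, ?_, ?_⟩
  · intro i hi
    -- The induction moves away from the edge. If `S j` were beyond it, its two common vertices with
    -- `S (j + 1)` would be `p i` and `q i`, and `S j` would be the face `S (i + 1)`.
    have key : ∀ d j, j + d = i → D.Within (p i) (q i) (s i) (S j) := by
      intro d
      induction d with
      | zero =>
        rintro j rfl
        exact (h j hi).2.2.2.1
      | succ d ih =>
        intro j hj
        obtain ⟨t, ht⟩ := (hface j (by omega)).exists_within (h i hi).1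
        by_cases hts : t ↔ s i
        · exact ht.congr hts
        exfalso
        have ht : D.Within (p i) (q i) (¬ s i) (S j) := ht.congr (by tauto)
        have hj' := h j (by omega)
        have hm := ((ih (j + 1) (by omega)).ends_mem ht hj'.1.ne hj'.2.2.1.1 hj'.2.1.1
          hj'.2.2.1.2 hj'.2.1.2).2
        have := hinj _ (by omega) _ (by omega) ((hface j (by omega)).eq_of_within
          (hface (i + 1) hi) (h i hi).1.ne hm.1 (h i hi).2.2.1.1 hm.2 (h i hi).2.2.1.2 ht
          (h i hi).2.2.2.2)
        omega
    exact fun j hj => key (i - j) j (by omega)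
  · intro i hi
    have key : ∀ d j, j = i + 1 + d → j ≤ k → D.Within (p i) (q i) (¬ s i) (S j) := by
      intro d
      induction d with
      | zero =>
        rintro j rfl _
        exact (h i hi).2.2.2.2
      | succ d ih =>
        rintro j rfl hjk
        obtain ⟨t, ht⟩ := (hface _ hjk).exists_within (h i hi).1
        by_cases hts : t ↔ s i
        · exfalso
          have ht := ht.congr hts
          have hj' := h (i + 1 + d) (by omega)
          have hm := (ht.ends_mem (ih (i + 1 + d) rfl (by omega)) hj'.1.ne hj'.2.2.1.1
            hj'.2.1.1 hj'.2.2.1.2 hj'.2.1.2).1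
          have := hinj _ hjk _ (by omega) ((hface _ hjk).eq_of_within (hface i hi.le)
            (h i hi).1.ne hm.1 (h i hi).2.1.1 hm.2 (h i hi).2.1.2 ht (h i hi).2.2.2.1)
          omega
        · exact ht.congr (by tauto)
    exact fun j hj hij => key (j - (i + 1)) j (by omega) hj

namespace IsFaceChain

variable (h : D.IsFaceChain k S p q s)
include h

theorem eq_of_mem {i j l : ℕ} (hji : j ≤ i) (hil : i < l) (hl : l ≤ k) {w : V} (hwj : w ∈ S j)
    (hwl : w ∈ S l) : w = p i ∨ w = q i :=
  (h.within_le i (by omega) j hji).eq_or_eq (h.within_gt i (by omega) l hl hil) hwj hwl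

/-- A chain of faces that covers all vertices contains all faces. -/
theorem exists_eq_of_cover (hcov : ∀ v, ∃ i ≤ k, v ∈ S i) {Q : Finset V} (hQ : D.IsInnerFace Q) :
    ∃ i ≤ k, Q = S i := by
  classical
  -- For the least such `i`, the face `Q` lies after edge `i - 1` and before edge `i`, so a vertex
  -- it shares with any `S j` is also in `S i`.
  have hex : ∃ i, i = k ∨ (i < k ∧ D.Within (p i) (q i) (s i) Q) := ⟨k, Or.inl rfl⟩
  let i := Nat.find hex
  have hi : i = k ∨ (i < k ∧ D.Within (p i) (q i) (s i) Q) := Nat.find_spec hex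
  have hik : i ≤ k := by rcases hi with hi | hi <;> omega
  refine ⟨i, hik, ((h.face i hik).eq_of_subset hQ fun z hz => ?_).symm⟩
  obtain ⟨j, hj, hzj⟩ := hcov z
  rcases lt_trichotomy j i with hji | rfl | hij
  · have hmin : ¬ _ := Nat.find_min hex (show i - 1 < i by omega)
    obtain ⟨t, ht⟩ := hQ.exists_within (h.adj (i - 1) (by omega))
    have ht : D.Within (p (i - 1)) (q (i - 1)) (¬ s (i - 1)) Q := ht.congr (by
      by_contra hts
      exact hmin (Or.inr ⟨by omega, ht.congr (by tauto)⟩))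
    have hm := h.right_mem (i - 1) (by omega)
    rw [Nat.sub_add_cancel (by omega)] at hm
    rcases (h.within_le (i - 1) (by omega) j (by omega)).eq_or_eq ht hzj hz with rfl | rfl
    exacts [hm.1, hm.2]
  · exact hzj
  · have hw : i < k ∧ D.Within (p i) (q i) (s i) Q := by
      rcases hi with hi | hi
      · omega
      · exact hi
    have hm := h.left_mem i hw.1
    rcases hw.2.eq_or_eq (h.within_gt i hw.1 j hj hij) hz hzj with rfl | rfl
    exacts [hm.1, hm.2]

/-- Triangular faces in a chain form a 2-tree. -/
theorem isTwoTree [DecidableEq V] (h3 : ∀ i, 0 < i → i ≤ k → (S i).card = 3) (hk : 0 < k) :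
    G.IsTwoTree ((Finset.Icc 1 k).biUnion S) := by
  -- The 2-tree grows from the far end: `S j` adds one vertex, which the edge `p j q j` separates
  -- from the later faces.
  have key : ∀ d j, j + d = k → 0 < j → G.IsTwoTree ((Finset.Icc j k).biUnion S) := by
    intro d
    induction d with
    | zero =>
      rintro j rfl hj
      rw [add_zero, Finset.Icc_self, Finset.singleton_biUnion]
      have hface := h.face j le_rfl
      obtain ⟨u, v, w, huv, huw, hvw, hS⟩ := Finset.card_eq_three.1 (h3 j hj le_rfl)
      have hu : u ∈ S j := by simp [hS]
      have hv : v ∈ S j := by simp [hS]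
      have hw : w ∈ S j := by simp [hS]
      have hadj := fun {a b : V} => hface.adj_of_card_eq_three (h3 j hj le_rfl) (u := a) (v := b)
      have := SimpleGraph.IsTwoTree.triangle (hadj hu hv huv) (hadj hu hw huw) (hadj hv hw hvw)
      rwa [← hS] at this
    | succ d ih =>
      intro j hjk hj
      have ih := ih (j + 1) (by omega) (by omega)
      have hface := h.face j (by omega)
      obtain ⟨w, hw, hwp, hwq⟩ := Finset.exists_mem_ne_ne hface.1 (p j) (q j)
      have hadj := h.adj j (by omega)
      have hl := h.left_mem j (by omega)
      have hr := h.right_mem j (by omega)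
      have hS : S j = insert w {p j, q j} := by
        refine (Finset.eq_of_subset_of_card_le ?_ ?_).symm
        · intro z
          simp only [Finset.mem_insert, Finset.mem_singleton]
          rintro (rfl | rfl | rfl)
          exacts [hw, hl.1, hl.2]
        · rw [h3 j hj (by omega), Finset.card_eq_three.2 ⟨w, p j, q j, hwp, hwq, hadj.ne, rfl⟩]
      have hsub : ∀ z ∈ S (j + 1), z ∈ (Finset.Icc (j + 1) k).biUnion S := fun z hz =>
        Finset.mem_biUnion.2 ⟨j + 1, Finset.mem_Icc.2 ⟨le_rfl, by omega⟩, hz⟩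
      have hT : (Finset.Icc j k).biUnion S = insert w ((Finset.Icc (j + 1) k).biUnion S) := by
        rw [← Finset.insert_Icc_add_one_left_eq_Icc (show j ≤ k by omega),
          Finset.biUnion_insert, hS]
        ext z
        simp only [Finset.mem_union, Finset.mem_insert, Finset.mem_singleton]
        constructor
        · rintro ((rfl | rfl | rfl) | hz)
          exacts [Or.inl rfl, Or.inr (hsub _ hr.1), Or.inr (hsub _ hr.2), Or.inr hz]
        · rintro (rfl | hz)
          exacts [Or.inl (Or.inl rfl), Or.inr hz]
      rw [hT]
      have hside : ∀ z ∈ (Finset.Icc (j + 1) k).biUnion S, z ≠ p j → z ≠ q j →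
          (D.OnArc (p j) (q j) z ↔ ¬ s j) := by
        intro z hz
        obtain ⟨l, hl, hzl⟩ := Finset.mem_biUnion.1 hz
        rw [Finset.mem_Icc] at hl
        exact h.within_gt j (by omega) l hl.2 (by omega) z hzl
      have hwside := h.within_le j (by omega) j le_rfl w hw hwp hwq
      have h3j := h3 j hj (by omega)
      refine SimpleGraph.IsTwoTree.step ih (hsub _ hr.1) (hsub _ hr.2) hadj ?_
        (hface.adj_of_card_eq_three h3j hw hl.1 hwp)
        (hface.adj_of_card_eq_three h3j hw hl.2 hwq) ?_
      · intro hwT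
        have := hside w hwT hwp hwq
        tauto
      · intro z hz hwz
        by_contra! hne
        have h1 := hside z hz hne.1 hne.2
        have h2 := onArc_iff_of_adj (D := D) hadj hwz hwp hwq hne.1 hne.2
        tauto
  exact key (k - 1) 1 (by omega) one_pos

end IsFaceChain

end OuterplaneDrawing

/-! ### The face structure of fundamental graphs -/

namespace OuterplaneDrawing

variable {V : Type*} [Fintype V] {G : SimpleGraph V} {D : OuterplaneDrawing G}

theorem IsFundamental.mem_fundamentalVerts {x y : V} (h : D.IsFundamental x y) (v : V) :
    v ∈ D.fundamentalVerts x y := by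
  have h1 : v ∈ (D.fundamentalSubgraph x y).verts := by rw [show _ = _ from h]; trivial
  exact h1

theorem IsFundamental.not_adj {x y : V} (h : D.IsFundamental x y) (hV : 3 ≤ Fintype.card V) :
    ¬ G.Adj x y := by
  intro hxy
  obtain ⟨w, -, hwx, hwy⟩ := Finset.exists_mem_ne_ne (S := Finset.univ) hV x y
  have := h.mem_fundamentalVerts w
  simp only [fundamentalVerts, if_pos hxy, Set.mem_insert_iff, Set.mem_singleton_iff] at this
  tauto

theorem IsFundamental.exists_walk {x y : V} (h : D.IsFundamental x y) (hV : 3 ≤ Fintype.card V)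
    (v : V) : ∃ (F F' : {S : Finset V // D.IsInnerFace S}) (w : D.weakDual.Walk F F'),
      D.IsShortestFacePath x y w ∧ ∃ S ∈ w.support, v ∈ S.1 := by
  have := h.mem_fundamentalVerts v
  rwa [fundamentalVerts, if_neg (h.not_adj hV)] at this

/-- A walk between faces on the two sides of an edge passes through any two faces which contain
that edge and lie on its two sides. -/
theorem exists_mem_support_of_within {F F' : {S : Finset V // D.IsInnerFace S}}
    (w : D.weakDual.Walk F F') {u v : V} (huv : G.Adj u v) {t : Prop} {S S' : Finset V}
    (hS : D.IsInnerFace S) (hS' : D.IsInnerFace S') (hu : u ∈ S ∧ v ∈ S) (hu' : u ∈ S' ∧ v ∈ S')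
    (ht : D.Within u v t S) (ht' : D.Within u v (¬ t) S') (hF : D.Within u v t F.1)
    (hF' : ¬ D.Within u v t F'.1) :
    (∃ E ∈ w.support, E.1 = S) ∧ ∃ E ∈ w.support, E.1 = S' := by
  -- Where the walk changes sides, two adjacent faces have two common vertices across `uv`; these
  -- are `u` and `v`, and each side has only one face at that edge.
  obtain ⟨d, hd, hd1, hd2⟩ := w.exists_boundary_dart {E | D.Within u v t E.1} hF hF'
  obtain ⟨-, a, b, hab, ha, hb⟩ := d.adj
  obtain ⟨t', hd2'⟩ := d.snd.2.exists_within huv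
  have hd2' : D.Within u v (¬ t) d.snd.1 := hd2'.congr (by
    by_contra hne
    exact hd2 (hd2'.congr (by tauto)))
  have hd1 : D.Within u v t d.fst.1 := hd1
  have hm := hd1.ends_mem hd2' hab.ne ha.1 hb.1 ha.2 hb.2
  exact ⟨⟨d.fst, w.dart_fst_mem_support_of_mem_darts hd,
    d.fst.2.eq_of_within hS huv.ne hm.1.1 hu.1 hm.1.2 hu.2 hd1 ht⟩,
    ⟨d.snd, w.dart_snd_mem_support_of_mem_darts hd,
    d.snd.2.eq_of_within hS' huv.ne hm.2.1 hu'.1 hm.2.2 hu'.2 hd2' ht'⟩⟩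

/-- The faces of an `xy`-fundamental graph form a chain from the only face at `x` to the only face
at `y`. -/
theorem IsFundamental.exists_chain {x y : V} (hfun : D.IsFundamental x y)
    (hV : 3 ≤ Fintype.card V) (hxy : x ≠ y) :
    ∃ k S p q s, D.IsFaceChain k S p q s ∧ (∀ i ≤ k, ∀ j ≤ k, S i = S j → i = j) ∧ x ∈ S 0 ∧
      y ∈ S k ∧ (∀ i ≤ k, 0 < i → x ∉ S i) ∧ ∀ v, ∃ i ≤ k, v ∈ S i := by
  classical
  have hnadj := hfun.not_adj hV
  obtain ⟨F, F', w, hw, -⟩ := hfun.exists_walk hV x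
  have hpath : w.IsPath := by
    have := SimpleGraph.Walk.bypass_eq_self_of_length_le_length_bypass w
      (hw.2.2 _ _ w.bypass hw.1 hw.2.1)
    rw [← this]
    exact w.bypass_isPath
  let S : ℕ → Finset V := fun i => (w.getVert i).1
  have hinj : ∀ i ≤ w.length, ∀ j ≤ w.length, S i = S j → i = j := fun i hi j hj hij =>
    hpath.getVert_injOn hi hj (Subtype.ext hij)
  have hface : ∀ i ≤ w.length, D.IsInnerFace (S i) := fun i _ => (w.getVert i).2
  have hx0 : x ∈ S 0 := by simpa [S] using hw.1
  have hyk : y ∈ S w.length := by simpa [S] using hw.2.1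
  have hx : ∀ i ≤ w.length, 0 < i → x ∉ S i := by
    intro i hi hpos hxi
    have := hw.2.2 _ _ (w.drop i) hxi hw.2.1
    rw [SimpleGraph.Walk.drop_length] at this
    omega
  have hy : ∀ i < w.length, y ∉ S i := by
    intro i hi hyi
    have := hw.2.2 _ _ (w.take i) hw.1 hyi
    rw [SimpleGraph.Walk.take_length] at this
    omega
  obtain ⟨p, q, s, hc⟩ := exists_isFaceChain hface hinj fun i hi => by
    obtain ⟨-, u, v, huv, hu, hv⟩ := w.adj_getVert_succ hi
    exact ⟨u, v, huv.ne, hu, hv⟩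
  refine ⟨w.length, S, p, q, s, hc, hinj, hx0, hyk, hx, fun v => ?_⟩
  obtain ⟨E, E', w', hw', Q, hQ, hvQ⟩ := hfun.exists_walk hV v
  have hlen : w'.length ≤ w.length := hw'.2.2 _ _ w hw.1 hw.2.1
  -- Each edge of the chain separates `x` from `y`, so another shortest walk passes through every
  -- face of `w`. Having no more faces than `w`, it visits no others, so a single walk already
  -- covers all vertices.
  have hmem : ∀ i ≤ w.length, ∃ R ∈ w'.support, R.1 = S i := by
    rcases Nat.eq_zero_or_pos w.length with h0 | hpos
    · intro i hi
      obtain rfl : i = 0 := by omega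
      refine ⟨E, w'.start_mem_support, ?_⟩
      -- Two different faces containing both `x` and `y` would make them adjacent.
      by_contra hne
      have hEE' : E = E' := SimpleGraph.Walk.eq_of_length_eq_zero (p := w') (by omega)
      exact hnadj (E.2.opposite (hface 0 (by omega)) hne hxy hw'.1 hx0
        (hEE' ▸ hw'.2.1) (by rw [h0] at hyk; exact hyk)).1
    · have key : ∀ i < w.length, (∃ R ∈ w'.support, R.1 = S i) ∧
          ∃ R ∈ w'.support, R.1 = S (i + 1) := by
        intro i hi
        have hr := hc.right_mem i hi
        have hl := hc.left_mem i hi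
        have hxs := hc.within_le i hi 0 (Nat.zero_le i) x hx0
          (fun h => hx (i + 1) hi (by omega) (h ▸ hr.1))
          (fun h => hx (i + 1) hi (by omega) (h ▸ hr.2))
        have hyp : y ≠ p i := fun h => hy i hi (h ▸ hl.1)
        have hyq : y ≠ q i := fun h => hy i hi (h ▸ hl.2)
        have hys := hc.within_gt i hi w.length le_rfl hi y hyk hyp hyq
        refine exists_mem_support_of_within w' (hc.adj i hi) (hface i hi.le) (hface (i + 1) hi)
          hl hr (hc.within_le i hi i le_rfl) (hc.within_gt i hi (i + 1) hi (by omega)) ?_ ?_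
        · obtain ⟨t, ht⟩ := E.2.exists_within (hc.adj i hi)
          have := ht x hw'.1 (fun h => hx (i + 1) hi (by omega) (h ▸ hr.1))
            (fun h => hx (i + 1) hi (by omega) (h ▸ hr.2))
          exact ht.congr (this.symm.trans hxs)
        · intro h
          have := h y hw'.2.1 hyp hyq
          tauto
      intro i hi
      rcases Nat.eq_zero_or_pos i with rfl | h
      · exact (key 0 hpos).1
      · have := (key (i - 1) (by omega)).2
        rwa [Nat.sub_add_cancel h] at this
  have himg : (Finset.range (w.length + 1)).image S = (w'.support.map Subtype.val).toFinset := by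
    refine Finset.eq_of_subset_of_card_le ?_ ?_
    · intro R hR
      obtain ⟨i, hi, rfl⟩ := Finset.mem_image.1 hR
      obtain ⟨R, hR, hRi⟩ := hmem i (by have := Finset.mem_range.1 hi; omega)
      exact List.mem_toFinset.2 (List.mem_map.2 ⟨R, hR, hRi⟩)
    · refine (List.toFinset_card_le _).trans ?_
      rw [Finset.card_image_of_injOn fun i hi j hj h => by
        rw [Finset.mem_coe, Finset.mem_range] at hi hj
        exact hinj i (by omega) j (by omega) h]
      simpa using hlen
  have : Q.1 ∈ (Finset.range (w.length + 1)).image S := by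
    rw [himg]
    exact List.mem_toFinset.2 (List.mem_map.2 ⟨Q, hQ, rfl⟩)
  obtain ⟨i, hi, hiQ⟩ := Finset.mem_image.1 this
  exact ⟨i, by have := Finset.mem_range.1 hi; omega, hiQ ▸ hvQ⟩

/-- On the boundary path from `b` to `a`, a neighbour of `b` has index 1 and a neighbour of `a` has
index `N.card - 2`; these differ. -/
theorem IsInnerFace.not_adj_of_four_le {N : Finset V} (hN : D.IsInnerFace N) (h4 : 4 ≤ N.card)
    {a b x : V} (ha : a ∈ N) (hb : b ∈ N) (hx : x ∈ N) (hab : G.Adj a b) (hxa : G.Adj x a) :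
    ¬ G.Adj x b := by
  intro hxb
  obtain ⟨f, hf0, hfl, hfinj, -, hfsurj, -, hfedge⟩ := hN.exists_path ha hb hab
  obtain ⟨j, hj, rfl⟩ := hfsurj x hx
  have h1 : j = 1 := by
    rcases hfedge _ hx b hb hxb with h | ⟨i, hi, h⟩
    · rcases Sym2.eq_iff.1 h with h | h
      · exact absurd h.1 hxa.ne
      · exact absurd h.1 hxb.ne
    · rw [← hf0] at h
      rcases Sym2.eq_iff.1 h with h | h
      · have := hfinj _ (by omega) _ hi h.2
        omega
      · have := hfinj _ (by omega) _ (by omega) h.2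
        have := hfinj _ (by omega) _ (by omega) h.1
        omega
  have h2 : j + 2 = N.card := by
    rcases hfedge _ hx a ha hxa with h | ⟨i, hi, h⟩
    · rcases Sym2.eq_iff.1 h with h | h
      · exact absurd h.1 hxa.ne
      · exact absurd h.1 hxb.ne
    · rw [← hfl] at h
      rcases Sym2.eq_iff.1 h with h | h
      · have := hfinj _ (by omega) _ (by omega) h.1
        have := hfinj _ (by omega) _ (by omega) h.2
        omega
      · have := hfinj _ (by omega) _ (by omega) h.2
        omega
  omega

open scoped Classical in
/-- The monomials of a chain of faces all of which except the first one are triangles. -/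
theorem IsFaceChain.exists_coeff_ne_zero {k : ℕ} {S : ℕ → Finset V} {p q : ℕ → V} {s : ℕ → Prop}
    (hc : D.IsFaceChain k S p q s) (hk : 0 < k) (h3 : ∀ i, 0 < i → i ≤ k → (S i).card = 3)
    (hN4 : 4 ≤ (S 0).card) (hcov : ∀ v, ∃ i ≤ k, v ∈ S i) {x y : V} (hx0 : x ∈ S 0)
    (hx : ∀ i ≤ k, 0 < i → x ∉ S i) (hyk : y ∈ S k) (hy0 : y ∉ S 0) {C : V → Fin 3}
    (hCT : ∀ u ∈ (Finset.Icc 1 k).biUnion S, ∀ v ∈ (Finset.Icc 1 k).biUnion S,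
      G.Adj u v → C u ≠ C v)
    {r : V → V → Prop} (hr : G.IsOrientation r) {a b : V}
    (hends : ∀ v, v = p 0 ∨ v = q 0 ↔ v = a ∨ v = b) (hadjab : G.Adj a b)
    (hxb : ¬ G.Adj x b) :
    ∃ μ : V →₀ ℕ, (G.graphPolynomial r).coeff μ ≠ 0 ∧ μ x = 0 ∧
      μ y = (if C a = C y then 1 else 0) ∧ ∀ v, v ≠ x → v ≠ y → μ v ≤ 2 := by
  have hpq := hc.adj 0 hk
  let T := (Finset.Icc 1 k).biUnion S
  have hmemT : ∀ v, v ∈ T ↔ ∃ i, 0 < i ∧ i ≤ k ∧ v ∈ S i := by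
    intro v
    simp only [T, Finset.mem_biUnion, Finset.mem_Icc]
    exact ⟨fun ⟨i, hi, hv⟩ => ⟨i, hi.1, hi.2, hv⟩, fun ⟨i, h1, h2, hv⟩ => ⟨i, ⟨h1, h2⟩, hv⟩⟩
  have hT : G.IsTwoTree T := hc.isTwoTree h3 hk
  change ∀ u ∈ T, ∀ v ∈ T, _ at hCT
  have hyT : y ∈ T := (hmemT y).2 ⟨k, hk, le_rfl, hyk⟩
  have hNT : ∀ v ∈ S 0, v ∈ T → v = p 0 ∨ v = q 0 := by
    intro v hv hvT
    obtain ⟨i, h1, h2, hvi⟩ := (hmemT v).1 hvT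
    exact hc.eq_of_mem le_rfl h1 h2 hv hvi
  have hpN := hc.left_mem 0 hk
  have hpT : p 0 ∈ T ∧ q 0 ∈ T := ⟨(hmemT _).2 ⟨1, one_pos, hk, (hc.right_mem 0 hk).1⟩,
    (hmemT _).2 ⟨1, one_pos, hk, (hc.right_mem 0 hk).2⟩⟩
  have hcovNT : ∀ v, v ∈ S 0 ∨ v ∈ T := by
    intro v
    obtain ⟨i, hi, hv⟩ := hcov v
    rcases Nat.eq_zero_or_pos i with rfl | h
    · exact Or.inl (hv)
    · exact Or.inr ((hmemT v).2 ⟨i, h, hi, hv⟩)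
  -- Such an edge would cross `p 0 q 0`. Hence every edge lies within `T` or within the large face.
  have hcross : ∀ u v, G.Adj u v → u ∉ T → v ∉ S 0 → False := by
    intro u v huv hu hv
    have huN := (hcovNT u).resolve_right hu
    obtain ⟨i, h1, h2, hvi⟩ := (hmemT v).1 ((hcovNT v).resolve_left hv)
    have hup : u ≠ p 0 := fun h => hu (h ▸ hpT.1)
    have huq : u ≠ q 0 := fun h => hu (h ▸ hpT.2)
    have hvp : v ≠ p 0 := fun h => hv (h ▸ hpN.1)
    have hvq : v ≠ q 0 := fun h => hv (h ▸ hpN.2)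
    have e1 := hc.within_le 0 hk 0 le_rfl u (huN) hup huq
    have e2 := hc.within_gt 0 hk i h2 h1 v hvi hvp hvq
    have e3 := OuterplaneDrawing.onArc_iff_of_adj (D := D) hpq huv hup huq hvp hvq
    tauto
  have hxT : x ∉ T := fun h => by
    obtain ⟨i, h1, h2, hxi⟩ := (hmemT x).1 h
    exact hx i h2 h1 hxi
  have hin : ∀ v, v = a ∨ v = b → v ∈ S 0 ∧ v ∈ T := by
    intro v hv
    rcases (hends v).2 hv with rfl | rfl
    exacts [⟨hpN.1, hpT.1⟩, ⟨hpN.2, hpT.2⟩]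
  have ha := hin a (Or.inl rfl)
  have hb := hin b (Or.inr rfl)
  obtain ⟨f, hf0, hfl, hfinj, hfN, hfsurj, hfadj, hfedge⟩ := (hc.face 0 (Nat.zero_le k)).exists_path ha.1 hb.1 hadjab
  obtain ⟨j, hj, hjx⟩ := hfsurj x hx0
  have hj0 : j ≠ 0 := by
    rintro rfl
    exact hxT (hjx ▸ hf0.symm ▸ hb.2)
  -- Non-adjacency of `x` and `b` gives the index at least 2 that the lists on the path require.
  have hj1 : j ≠ 1 := by
    rintro rfl
    have := hfadj 0 (by omega)
    rw [hf0, zero_add, hjx] at this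
    exact hxb this.symm
  have hjl : j ≠ (S 0).card - 1 := by
    rintro rfl
    exact hxT (hjx ▸ hfl.symm ▸ ha.2)
  have hmid : ∀ i, 0 < i → i + 1 < (S 0).card → f i ∉ T := by
    intro i hpos hi hiT
    rcases (hends _).1 (hNT _ (hfN i (by omega)) hiT) with h | h
    · have := hfinj i (by omega) _ (by omega) (h.trans hfl.symm)
      omega
    · have := hfinj i (by omega) _ (by omega) (h.trans hf0.symm)
      omega
  obtain ⟨μ, h1, h2, h3, h4⟩ := SimpleGraph.exists_coeff_ne_zero_of_path hr hT C hCT f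
    (S 0).card j (by omega) (by omega) hfinj (hf0 ▸ hb.2) (hfl ▸ ha.2) hmid
    (fun v => by
      rcases hcovNT v with hv | hv
      · by_cases hvT : v ∈ T
        · exact Or.inl hvT
        obtain ⟨i, hi, rfl⟩ := hfsurj v hv
        refine Or.inr ⟨i, ?_, ?_, rfl⟩
        · rcases Nat.eq_zero_or_pos i with rfl | h
          · exact absurd (hf0 ▸ hb.2) hvT
          · exact h
        · by_contra h
          obtain rfl : i = (S 0).card - 1 := by omega
          exact hvT (hfl ▸ ha.2)
      · exact Or.inl hv)
    hfadj
    (fun u v huv => by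
      by_cases huvT : u ∈ T ∧ v ∈ T
      · exact Or.inl huvT
      have huN : u ∈ S 0 := by
        by_contra h
        exact hcross v u huv.symm
          (fun hv => huvT ⟨(hcovNT u).resolve_left h, hv⟩) h
      have hvN : v ∈ S 0 := by
        by_contra h
        exact hcross u v huv (fun hu => huvT ⟨hu, (hcovNT v).resolve_left h⟩) h
      rcases hfedge u huN v hvN huv with h | h
      · rcases Sym2.eq_iff.1 h with ⟨rfl, rfl⟩ | ⟨rfl, rfl⟩
        · exact Or.inl ⟨ha.2, hb.2⟩
        · exact Or.inl ⟨hb.2, ha.2⟩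
      · exact Or.inr h)
    (by rw [hf0, hfl]; exact hadjab.symm) hyT
    (fun h => hy0 (h ▸ hf0.symm ▸ hb.1)) (fun h => hy0 (h ▸ hfl.symm ▸ ha.1))
  rw [hjx] at h2 h4
  rw [hfl] at h3
  exact ⟨μ, h1, h2, h3, h4⟩

end OuterplaneDrawing

/-! ### Choice of the end that absorbs a path edge -/

theorem theorem12 {V : Type*} [Fintype V] (G : SimpleGraph V) (hG : G.IsTwoConnected)
    (D : OuterplaneDrawing G) (x y : V) (hxy : D.IsFundamental x y)
    -- `N` is the only non-triangular inner face; it contains `x` and not `y`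
    (N : {S : Finset V // D.IsInnerFace S}) (hN : N.1.card ≠ 3)
    (hN_unique : ∀ S : Finset V, D.IsInnerFace S → S.card ≠ 3 → S = N.1)
    (hxN : x ∈ N.1) (hyN : y ∉ N.1)
    -- `a`, `b` are the vertices that `N` shares with the neighbouring inner face `M`
    (M : {S : Finset V // D.IsInnerFace S}) (hNM : D.weakDual.Adj N M)
    (a b : V) (hab : ∀ v, (v ∈ N.1 ∧ v ∈ M.1) ↔ (v = a ∨ v = b))
    (C : V → Fin 3) (hC : D.IsTriangularColouring C)
    (r : V → V → Prop) (hr : G.IsOrientation r) :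
    (((G.Adj x a ∧ C a = C y) ∨ (G.Adj x b ∧ C b = C y)) →
      ∃ m : V →₀ ℕ, (G.graphPolynomial r).coeff m ≠ 0 ∧ m x = 0 ∧ m y = 1 ∧
        ∀ v, v ≠ x → v ≠ y → m v ≤ 2) ∧
    (¬ ((G.Adj x a ∧ C a = C y) ∨ (G.Adj x b ∧ C b = C y)) →
      ∃ m : V →₀ ℕ, (G.graphPolynomial r).coeff m ≠ 0 ∧ m x = 0 ∧ m y = 0 ∧
        ∀ v, v ≠ x → v ≠ y → m v ≤ 2) := by
  classical
  have hxny : x ≠ y := fun h => hyN (h ▸ hxN)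
  obtain ⟨k, S, p, q, s, hc, hinj, hx0, hyk, hx, hcov⟩ := hxy.exists_chain hG.1 hxny
  obtain ⟨i, hi, hNi⟩ := hc.exists_eq_of_cover hcov N.2
  have hN0 : N.1 = S 0 := by
    rcases Nat.eq_zero_or_pos i with rfl | h
    · exact hNi
    · exact absurd (hNi ▸ hxN) (hx i hi h)
  have hk : 0 < k := by
    rcases Nat.eq_zero_or_pos k with rfl | h
    · exact absurd (hN0 ▸ hyk) hyN
    · exact h
  have h3 : ∀ i, 0 < i → i ≤ k → (S i).card = 3 := by
    intro i hpos hi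
    by_contra hne
    have := hinj i hi 0 (Nat.zero_le k) ((hN_unique _ (hc.face i hi) hne).trans hN0)
    omega
  -- Every face other than `N` lies beyond the edge `p 0 q 0`, so whatever edge `M` shares with `N`
  -- is this one.
  have hends : ∀ v, v = p 0 ∨ v = q 0 ↔ v = a ∨ v = b := by
    obtain ⟨j, hj, hMj⟩ := hc.exists_eq_of_cover hcov M.2
    have hj0 : 0 < j := by
      rcases Nat.eq_zero_or_pos j with rfl | h
      · exact absurd (Subtype.ext (hN0.trans hMj.symm)) hNM.ne
      · exact h
    obtain ⟨-, u, v, huv, hu, hv⟩ := hNM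
    have hm := (hc.within_le 0 hk 0 le_rfl).ends_mem (hc.within_gt 0 hk j hj hj0) huv.ne
      (hN0 ▸ hu.1) (hMj ▸ hv.1) (hN0 ▸ hu.2) (hMj ▸ hv.2)
    intro v
    rw [← hab]
    constructor
    · rintro (rfl | rfl)
      · exact ⟨hN0 ▸ hm.1.1, hMj ▸ hm.2.1⟩
      · exact ⟨hN0 ▸ hm.1.2, hMj ▸ hm.2.2⟩
    · rintro ⟨h1, h2⟩
      exact hc.eq_of_mem le_rfl hj0 hj (hN0 ▸ h1) (hMj ▸ h2)
  have hpq := hc.adj 0 hk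
  have hadjab : G.Adj a b := by
    have h1 := (hends _).1 (Or.inl rfl)
    have h2 := (hends _).1 (Or.inr rfl)
    have h3 := hpq.ne
    have h4 := hpq.symm
    rcases h1 with h1 | h1 <;> rcases h2 with h2 | h2 <;> simp_all
  have hCT : ∀ u ∈ (Finset.Icc 1 k).biUnion S, ∀ v ∈ (Finset.Icc 1 k).biUnion S,
      G.Adj u v → C u ≠ C v := by
    have htri : ∀ u ∈ (Finset.Icc 1 k).biUnion S, D.OnTriangularFace u := fun u hu => by
      obtain ⟨i, hi, hu⟩ := Finset.mem_biUnion.1 hu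
      rw [Finset.mem_Icc] at hi
      exact ⟨S i, hc.face i hi.2, h3 i hi.1 hi.2, hu⟩
    exact fun u hu v hv huv => hC u v (htri u hu) (htri v hv) huv
  have hN4 : 4 ≤ N.1.card := by
    have := N.2.1
    omega
  have key := fun (a b : V) => hc.exists_coeff_ne_zero hk h3 (hN0 ▸ hN4) hcov hx0 hx hyk
    (hN0 ▸ hyN) hCT hr (a := a) (b := b)
  have hends' : ∀ v, v = p 0 ∨ v = q 0 ↔ v = b ∨ v = a := fun v => (hends v).trans or_comm
  have hCab : C a ≠ C b := by
    have hin : ∀ v, v = a ∨ v = b → v ∈ (Finset.Icc 1 k).biUnion S := by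
      intro v hv
      have hr := hc.right_mem 0 hk
      refine Finset.mem_biUnion.2 ⟨1, Finset.mem_Icc.2 ⟨le_rfl, hk⟩, ?_⟩
      rcases (hends v).2 hv with rfl | rfl
      exacts [hr.1, hr.2]
    exact hCT a (hin a (Or.inl rfl)) b (hin b (Or.inr rfl)) hadjab
  have hxab : ¬ (G.Adj x a ∧ G.Adj x b) := fun h =>
    N.2.not_adj_of_four_le hN4 ((hab a).2 (Or.inl rfl)).1 ((hab b).2 (Or.inr rfl)).1 hxN hadjab
      h.1 h.2
  constructor
  -- The neighbour of `x` has to be the absorbing end; its colour is that of `y`, whence exponent 1.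
  · rintro (⟨hxa, hay⟩ | ⟨hxb, hby⟩)
    · obtain ⟨μ, h1, h2, h3, h4⟩ := key a b hends hadjab fun h => hxab ⟨hxa, h⟩
      exact ⟨μ, h1, h2, by rw [h3, if_pos hay], h4⟩
    · obtain ⟨μ, h1, h2, h3, h4⟩ := key b a hends' hadjab.symm fun h => hxab ⟨h, hxb⟩
      exact ⟨μ, h1, h2, by rw [h3, if_pos hby], h4⟩
  · intro hno
    -- Exponent 0 needs an absorbing end coloured differently from `y` and the other end not
    -- adjacent to `x`. If `a` does not qualify as the absorbing end, `b` does, since `C a ≠ C b`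
    -- and `x` is adjacent to at most one of them.
    by_cases h : C a ≠ C y ∧ ¬ G.Adj x b
    · obtain ⟨μ, h1, h2, h3, h4⟩ := key a b hends hadjab h.2
      exact ⟨μ, h1, h2, by rw [h3, if_neg h.1], h4⟩
    · have h' : C b ≠ C y ∧ ¬ G.Adj x a := by
        by_cases hay : C a = C y
        · exact ⟨fun h => hCab (hay.trans h.symm), fun hxa => hno (Or.inl ⟨hxa, hay⟩)⟩
        · have hxb : G.Adj x b := by tauto
          exact ⟨fun hby => hno (Or.inr ⟨hxb, hby⟩), fun hxa => hxab ⟨hxa, hxb⟩⟩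
      obtain ⟨μ, h1, h2, h3, h4⟩ := key b a hends' hadjab.symm h'.2
      exact ⟨μ, h1, h2, by rw [h3, if_neg h'.1], h4⟩
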